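/- Let $V:\mathbb R\to(-\infty,+\infty]$ be a measurable potential (the weight $e^{-V}$ is $0$ where $V=+\infty$), and let $\rho_t(x)=e^{-V(x)+tx}$ be the weight of the corresponding unitary ensemble modified by the first Toda time $t$. Let $J=[a_0,a_1]\cup[a_2,a_3]\cup\dots\cup[a_{2m-2},a_{2m-1}]\subset\mathbb R$ with $-\infty\le a_0<a_1<\dots<a_{2m-1}\le+\infty$ (an interval with an infinite endpoint being a half-line or the whole line), and for an integer $n\ge 0$ put $$\tau_n^J(t)=\frac1{n!}\int_{J^n}\prod_{1\le i<j\le n}(x_j-x_i)^2\prod_{i=1}^n\rho_t(x_i)\,dx_1\cdots dx_n,\qquad \tau_n(t)=\tau_n^{\mathbb R}(t),\qquad \tau_0^J=1 .$$ Let $\xi_0=a_k$ be any one of the finite endpoints of $J$, and suppose that $V$ is finite and differentiable in a neighbourhood of $\xi_0$. Let $t_0$ be a Toda time such that $\rho_t$ is integrable on $\mathbb R$ for all $t$ in a neighbourhood of $t_0$. Move the endpoint $a_k=\xi$, keeping the other endpoints fixed, and regard $$T(\xi,t)=\ln\tau_n^J(t)$$ as a function of $(\xi,t)$ near $(\xi_0,t_0)$.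 Then $\tau_n>0$ and $\tau_n^J>0$, and $T=\ln\mathrm{Pr}+\ln\tau_n$, where $\mathrm{Pr}>0$ is the gap probability, i.e. the probability that none of the $n$ eigenvalues, distributed with density $\frac{1}{n!\,\tau_n(t)}\prod_{i<j}(x_j-x_i)^2\prod_i\rho_t(x_i)$, lies in $\mathbb R\setminus J$. Moreover the partial derivatives $T_\xi$, $T_t$, $T_{\xi\xi}$, $T_{\xi t}$, $T_{tt}$, $T_{\xi\xi t}$, $T_{\xi tt}$, $T_{\xi\xi tt}$ exist near $(\xi_0,t_0)$, independently of the order of differentiation, and satisfy there the universal (i.e. not depending on $V$) PDE $$\left(T_{\xi t}T_{\xi\xi tt}-T_{\xi tt}T_{\xi\xi t}+2T_{\xi t}^3\right)^2=T_\xi^2\left(4T_{tt}T_{\xi t}^2+T_{\xi tt}^2\right).$$ -/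

import Mathlib

open Filter Topology MeasureTheory

namespace UnitaryEnsemble

noncomputable section

/-- The weight `e^{-V(x) + t x}` of the ensemble with potential `V`, modified by the first Toda
time `t`. The set `S` is the set on which the potential is finite; the weight vanishes off `S`
(for instance `S = ℝ` for the Gaussian ensemble, `S = (0, ∞)` for the Laguerre ensemble). -/
def weight (V : ℝ → ℝ) (S : Set ℝ) (t x : ℝ) : ℝ :=
  S.indicator (fun y => Real.exp (-V y + t * y)) x

/-- The unnormalized joint eigenvalue density `Δ_n(x)² ∏ ρ_t(x_i)`. -/
def jointWeight (V : ℝ → ℝ) (S : Set ℝ) (n : ℕ) (t : ℝ) (x : Fin n → ℝ) : ℝ :=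
  (∏ i : Fin n, ∏ j ∈ Finset.Ioi i, (x j - x i)) ^ 2 * ∏ i : Fin n, weight V S t (x i)

/-- The matrix integral `τ_n^J(t) = (1/n!) ∫_{J^n} Δ_n(x)² ∏ ρ_t(x_i) dx_i`. -/
def tau (V : ℝ → ℝ) (S : Set ℝ) (n : ℕ) (J : Set ℝ) (t : ℝ) : ℝ :=
  (1 / (n.factorial : ℝ)) * ∫ x in {x : Fin n → ℝ | ∀ i, x i ∈ J}, jointWeight V S n t x

/-- The law of the `n` (unordered, labelled) eigenvalues of the ensemble at Toda time `t`. -/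
def eigenvalueLaw (V : ℝ → ℝ) (S : Set ℝ) (n : ℕ) (t : ℝ) : Measure (Fin n → ℝ) :=
  volume.withDensity fun x =>
    ENNReal.ofReal (jointWeight V S n t x / ((n.factorial : ℝ) * tau V S n Set.univ t))

/-- The gap probability: the probability that the complement of `J` contains no eigenvalue. -/
def gapProb (V : ℝ → ℝ) (S : Set ℝ) (n : ℕ) (J : Set ℝ) (t : ℝ) : ℝ :=
  (eigenvalueLaw V S n t).real {x | ∀ i, x i ∉ Jᶜ}

/-- The union of intervals `J = [a_0, a_1] ∪ [a_2, a_3] ∪ … ∪ [a_{2m-2}, a_{2m-1}]` in the real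
line; the endpoints are extended reals, so that `a_0 = -∞` and `a_{2m-1} = ∞` are allowed. -/
def intervals {m : ℕ} (a : Fin (2 * m) → EReal) : Set ℝ :=
  {x : ℝ | ∃ j : Fin m, a ⟨2 * j, by omega⟩ ≤ (x : EReal) ∧ (x : EReal) ≤ a ⟨2 * j + 1, by omega⟩}

/-- The set `J` with its `k`-th endpoint moved to `x`, the other endpoints being fixed. -/
def movedIntervals {m : ℕ} (a : Fin (2 * m) → EReal) (k : Fin (2 * m)) (x : ℝ) : Set ℝ :=
  intervals (Function.update a k (x : EReal))

/-- `T = ln τ_n^J` as a function of the position `x` of the `k`-th endpoint of `J` and of the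
first Toda time `t`. -/
def logTau (V : ℝ → ℝ) (S : Set ℝ) (n : ℕ) {m : ℕ} (a : Fin (2 * m) → EReal) (k : Fin (2 * m))
    (x t : ℝ) : ℝ :=
  Real.log (tau V S n (movedIntervals a k x) t)

/-- At the point `p`, the function `f` of `(ξ, t)` has the partial derivative `g` in `ξ`. -/
def HasPartialXi (f g : ℝ → ℝ → ℝ) (p : ℝ × ℝ) : Prop :=
  HasDerivAt (fun x => f x p.2) (g p.1 p.2) p.1

/-- At the point `p`, the function `f` of `(ξ, t)` has the partial derivative `g` in `t`. -/
def HasPartialT (f g : ℝ → ℝ → ℝ) (p : ℝ × ℝ) : Prop :=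
  HasDerivAt (fun s => f p.1 s) (g p.1 p.2) p.2

end

end UnitaryEnsemble

open Polynomial

namespace UnitaryEnsemble

/-! ### Moment functionals and their monic orthogonal polynomials. -/

noncomputable section

/-! By Heine's formula (`tau_eq_prod_sqNorm`), `τ_n^J = h_0 ⋯ h_{n-1}`, where `h_j` is the squared
norm of the monic orthogonal polynomial `p_j` of the weight on `J`. Hence `T = ∑_{j<n} log h_j`. The
PDE then rests on two properties of the moments `μ_k`: `∂_t μ_k = μ_{k+1}`, and `∂_ξ μ_k = ξ^k r`,
where `r` is plus or minus the weight at the moving endpoint; `IsMomentFamily` axiomatises this.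

For `n ≥ 1` put `u = p_n(ξ)`, `v = p_{n-1}(ξ)`, `g = h_n`, `h = h_{n-1}`, `K = ∑_{j<n} p_j(ξ)²/h_j`.
Differentiating the orthogonality relations gives `T_ξ = rK`, `T_tt = g/h` (the Toda equation),
`T_ξt = ruv/h` and `T_ξtt = ∂_ξ(g/h) = P - Q` with `P = ru²/h`, `Q = rgv²/h²`. Since `PQ = T_tt
T_ξt²`, the right side of the PDE is `T_ξ²(P + Q)²`.

On the left, `T_ξt T_ξξtt - T_ξtt T_ξξt` is formally `T_ξt² ∂_ξ(T_ξtt/T_ξt)`, and `T_ξtt/T_ξt = u/v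
- (g/h)v/u` no longer contains `r`: this is why `V` disappears. The derivative involves the
Wronskian of `p_n` and `p_{n-1}` at `ξ`, which is `Kh` by the confluent Christoffel-Darboux formula
(`diagKernel_succ_mul`); the dependence of the polynomials and norms on `ξ` contributes exactly
`-2T_ξt³`. The bracket is therefore `T_ξ(P + Q)`; see `edge_wronskian_identity`.

As `V'` need not be continuous, symmetry of mixed derivatives is not deduced from `C²` regularity.
It is propagated algebraically (`MixedDiff`) from the moments and `r` to every function in play. -/

/-- The linear functional on polynomials with moments `μ k`. -/
def momentFunctional (μ : ℕ → ℝ) : ℝ[X] →ₗ[ℝ] ℝ :=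
  Polynomial.lsum fun k => μ k • LinearMap.id

theorem momentFunctional_eq_sum (μ : ℕ → ℝ) {q : ℝ[X]} {N : ℕ} (hq : q.natDegree < N) :
    momentFunctional μ q = ∑ k ∈ Finset.range N, q.coeff k * μ k := by
  rw [momentFunctional, Polynomial.lsum_apply, Polynomial.sum_over_range' _ _ N hq]
  · simp [mul_comm]
  · simp

theorem momentFunctional_X_pow (μ : ℕ → ℝ) (k : ℕ) : momentFunctional μ (X ^ k) = μ k := by
  rw [momentFunctional_eq_sum μ (N := k + 1) (by simp)]
  simp [coeff_X_pow]

/-- Positive definiteness of a functional on polynomials. -/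
def PosDefFunctional (L : ℝ[X] →ₗ[ℝ] ℝ) : Prop := ∀ q : ℝ[X], q ≠ 0 → 0 < L (q * q)

/-- The monic orthogonal polynomials of `L`, by the Gram-Schmidt process. -/
def orthoPoly (L : ℝ[X] →ₗ[ℝ] ℝ) (n : ℕ) : ℝ[X] :=
  X ^ n - ∑ i : Fin n,
    C (L (X ^ n * orthoPoly L i) / L (orthoPoly L i * orthoPoly L i)) * orthoPoly L i
termination_by n
decreasing_by exact i.2

/-- The squared norms of the monic orthogonal polynomials. -/
def sqNorm (L : ℝ[X] →ₗ[ℝ] ℝ) (n : ℕ) : ℝ := L (orthoPoly L n * orthoPoly L n)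

theorem orthoPoly_eq (L : ℝ[X] →ₗ[ℝ] ℝ) (n : ℕ) :
    orthoPoly L n = X ^ n - ∑ i ∈ Finset.range n,
      C (L (X ^ n * orthoPoly L i) / sqNorm L i) * orthoPoly L i := by
  rw [orthoPoly, Finset.sum_range]
  rfl

theorem orthoPoly_zero (L : ℝ[X] →ₗ[ℝ] ℝ) : orthoPoly L 0 = 1 := by
  rw [orthoPoly_eq]; simp

theorem degree_orthoPoly_sub_lt (L : ℝ[X] →ₗ[ℝ] ℝ) (n : ℕ) :
    (orthoPoly L n - X ^ n).degree < (n : WithBot ℕ) := by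
  induction n using Nat.strong_induction_on with
  | _ n ih =>
    rw [orthoPoly_eq, sub_sub_cancel_left, degree_neg, ← mem_degreeLT]
    refine Submodule.sum_mem _ fun i hi => ?_
    have hi := Finset.mem_range.1 hi
    rw [← smul_eq_C_mul]
    refine Submodule.smul_mem _ _ ?_
    have h : orthoPoly L i = (orthoPoly L i - X ^ i) + X ^ i := by ring
    rw [h]
    refine Submodule.add_mem _ ?_ ?_
    · rw [mem_degreeLT]
      exact (ih i hi).trans (by exact_mod_cast hi)
    · rw [mem_degreeLT, degree_X_pow]
      exact_mod_cast hi

theorem degree_orthoPoly (L : ℝ[X] →ₗ[ℝ] ℝ) (n : ℕ) : (orthoPoly L n).degree = n := by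
  have h : orthoPoly L n = (orthoPoly L n - X ^ n) + X ^ n := by ring
  rw [h, degree_add_eq_right_of_degree_lt, degree_X_pow]
  simpa using degree_orthoPoly_sub_lt L n

theorem natDegree_orthoPoly (L : ℝ[X] →ₗ[ℝ] ℝ) (n : ℕ) : (orthoPoly L n).natDegree = n :=
  natDegree_eq_of_degree_eq_some (degree_orthoPoly L n)

theorem coeff_orthoPoly_self (L : ℝ[X] →ₗ[ℝ] ℝ) (n : ℕ) : (orthoPoly L n).coeff n = 1 := by
  have h := coeff_eq_zero_of_degree_lt (degree_orthoPoly_sub_lt L n)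
  rw [coeff_sub, coeff_X_pow_self] at h
  linarith

theorem monic_orthoPoly (L : ℝ[X] →ₗ[ℝ] ℝ) (n : ℕ) : (orthoPoly L n).Monic := by
  rw [Monic, leadingCoeff, natDegree_orthoPoly, coeff_orthoPoly_self]

theorem degree_orthoPoly_lt (L : ℝ[X] →ₗ[ℝ] ℝ) (n : ℕ) :
    (orthoPoly L n).degree < ((n + 1 : ℕ) : WithBot ℕ) := by
  rw [degree_orthoPoly]; exact_mod_cast n.lt_succ_self

/-- A polynomial of degree at most `n` is a multiple of the `n`-th orthogonal polynomial plus a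
polynomial of lower degree. -/
theorem degree_sub_coeff_mul_orthoPoly_lt (L : ℝ[X] →ₗ[ℝ] ℝ) {n : ℕ} {q : ℝ[X]}
    (hq : q.degree < ((n + 1 : ℕ) : WithBot ℕ)) :
    (q - C (q.coeff n) * orthoPoly L n).degree < n := by
  rw [degree_lt_iff_coeff_zero] at hq ⊢
  intro k hk
  rcases hk.eq_or_lt with rfl | hk
  · simp [coeff_orthoPoly_self]
  · have h : (orthoPoly L n).coeff k = 0 :=
      coeff_eq_zero_of_natDegree_lt (by rwa [natDegree_orthoPoly])
    simp [h, hq k hk]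

/-- A linear functional vanishing on the first `n` orthogonal polynomials vanishes on all
polynomials of degree less than `n`. -/
theorem eq_zero_of_orthoPoly (L M : ℝ[X] →ₗ[ℝ] ℝ) {n : ℕ}
    (hM : ∀ j < n, M (orthoPoly L j) = 0) {q : ℝ[X]} (hq : q.degree < n) : M q = 0 := by
  induction n generalizing q with
  | zero =>
    have : q = 0 := by simpa using hq
    simp [this]
  | succ n ih =>
    have h := ih (fun j hj => hM j (by omega)) (degree_sub_coeff_mul_orthoPoly_lt L hq)
    rw [map_sub, ← smul_eq_C_mul, map_smul, hM n (by omega)] at h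
    simpa using h

section OrthogonalPolynomials

variable {L : ℝ[X] →ₗ[ℝ] ℝ}

theorem sqNorm_pos (hL : PosDefFunctional L) (n : ℕ) : 0 < sqNorm L n :=
  hL _ (monic_orthoPoly L n).ne_zero

theorem orthoPoly_mul_eq_zero_of_lt (hL : PosDefFunctional L) {n m : ℕ} (h : m < n) :
    L (orthoPoly L n * orthoPoly L m) = 0 := by
  induction n using Nat.strong_induction_on generalizing m with
  | _ n ih =>
    rw [orthoPoly_eq, sub_mul, map_sub, Finset.sum_mul, map_sum,
      Finset.sum_eq_single_of_mem m (Finset.mem_range.2 h)]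
    · rw [mul_assoc, ← smul_eq_C_mul, map_smul, smul_eq_mul, ← sqNorm,
        div_mul_cancel₀ _ (sqNorm_pos hL m).ne', sub_self]
    · intro i hi him
      rw [mul_assoc, ← smul_eq_C_mul, map_smul, smul_eq_mul]
      rcases him.lt_or_gt with h1 | h1
      · rw [mul_comm (orthoPoly L i), ih m h h1, mul_zero]
      · rw [ih i (Finset.mem_range.1 hi) h1, mul_zero]

/-- The functional `q ↦ L (p * q)`. -/
def mulFunctional (L : ℝ[X] →ₗ[ℝ] ℝ) (p : ℝ[X]) : ℝ[X] →ₗ[ℝ] ℝ := L ∘ₗ LinearMap.mulLeft ℝ p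

theorem orthoPoly_mul_eq_zero (hL : PosDefFunctional L) {n : ℕ} {q : ℝ[X]} (hq : q.degree < n) :
    L (orthoPoly L n * q) = 0 :=
  eq_zero_of_orthoPoly L (mulFunctional L (orthoPoly L n))
    (fun _ hj => orthoPoly_mul_eq_zero_of_lt hL hj) hq

theorem orthoPoly_mul_eq_coeff (hL : PosDefFunctional L) {n : ℕ} {q : ℝ[X]}
    (hq : q.degree < ((n + 1 : ℕ) : WithBot ℕ)) :
    L (orthoPoly L n * q) = q.coeff n * sqNorm L n := by
  have h := orthoPoly_mul_eq_zero hL (degree_sub_coeff_mul_orthoPoly_lt L hq)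
  rw [mul_sub, map_sub, mul_left_comm, ← smul_eq_C_mul, map_smul, smul_eq_mul, ← sqNorm] at h
  linarith

/-- A polynomial of degree less than `n` orthogonal to the first `n` orthogonal polynomials
vanishes. -/
theorem eq_zero_of_forall_mul_orthoPoly (hL : PosDefFunctional L) {n : ℕ} {q : ℝ[X]}
    (hq : q.degree < n) (h : ∀ j < n, L (q * orthoPoly L j) = 0) : q = 0 := by
  by_contra hne
  exact (hL q hne).ne' (eq_zero_of_orthoPoly L (mulFunctional L q) h hq)

theorem degree_X_mul_lt {q : ℝ[X]} {n : ℕ} (hq : q.degree < n) :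
    (X * q).degree < ((n + 1 : ℕ) : WithBot ℕ) := by
  rw [degree_lt_iff_coeff_zero] at hq ⊢
  intro k hk
  obtain ⟨k, rfl⟩ : ∃ l, k = l + 1 := ⟨k - 1, by omega⟩
  rw [coeff_X_mul]
  exact hq k (by omega)

theorem X_mul_orthoPoly_succ_mul (hL : PosDefFunctional L) (n : ℕ) :
    L (X * orthoPoly L (n + 1) * orthoPoly L n) = sqNorm L (n + 1) := by
  rw [mul_comm X, mul_assoc, orthoPoly_mul_eq_coeff hL
    (degree_X_mul_lt (degree_orthoPoly_lt L n)), coeff_X_mul, coeff_orthoPoly_self, one_mul]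

/-- The diagonal recurrence coefficients. -/
theorem X_mul_orthoPoly_mul_self (hL : PosDefFunctional L) (n : ℕ) :
    L (X * (orthoPoly L n * orthoPoly L n)) =
      ((X * orthoPoly L n).coeff n - (orthoPoly L (n + 1)).coeff n) * sqNorm L n := by
  have hd : (X * orthoPoly L n - orthoPoly L (n + 1)).degree < ((n + 1 : ℕ) : WithBot ℕ) := by
    have h := degree_sub_coeff_mul_orthoPoly_lt L (degree_X_mul_lt (degree_orthoPoly_lt L n))
    rwa [coeff_X_mul, coeff_orthoPoly_self, map_one, one_mul] at h
  have h := orthoPoly_mul_eq_coeff hL hd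
  rw [coeff_sub, mul_sub, map_sub, mul_comm _ (orthoPoly L (n + 1)),
    orthoPoly_mul_eq_zero hL (degree_orthoPoly_lt L n), sub_zero] at h
  rw [← h]; congr 1; ring

/-- The three-term recurrence. -/
theorem orthoPoly_add_two (hL : PosDefFunctional L) (n : ℕ) : ∃ a : ℝ,
    orthoPoly L (n + 2) = (X - C a) * orthoPoly L (n + 1)
      - C (sqNorm L (n + 1) / sqNorm L n) * orthoPoly L n := by
  set c : ℝ := (X * orthoPoly L (n + 1) - orthoPoly L (n + 2)).coeff (n + 1) with hc
  have hd : (X * orthoPoly L (n + 1) - orthoPoly L (n + 2)).degree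
      < ((n + 1 + 1 : ℕ) : WithBot ℕ) := by
    have h := degree_sub_coeff_mul_orthoPoly_lt L
      (degree_X_mul_lt (degree_orthoPoly_lt L (n + 1)))
    rwa [coeff_X_mul, coeff_orthoPoly_self, map_one, one_mul] at h
  refine ⟨c, ?_⟩
  have hd2 := degree_sub_coeff_mul_orthoPoly_lt L hd
  rw [← hc] at hd2
  -- The remainder has degree at most `n` and is orthogonal to `p_0, …, p_n`; positivity forces it
  -- to vanish.
  have key : X * orthoPoly L (n + 1) - orthoPoly L (n + 2) - C c * orthoPoly L (n + 1)
      - C (sqNorm L (n + 1) / sqNorm L n) * orthoPoly L n = 0 := by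
    refine eq_zero_of_forall_mul_orthoPoly hL (n := n + 1) ?_ ?_
    · rw [← mem_degreeLT] at hd2 ⊢
      refine Submodule.sub_mem _ hd2 ?_
      rw [← smul_eq_C_mul]
      exact Submodule.smul_mem _ _ (mem_degreeLT.2 (degree_orthoPoly_lt L n))
    · intro j hj
      have e : (X * orthoPoly L (n + 1) - orthoPoly L (n + 2) - C c * orthoPoly L (n + 1)
          - C (sqNorm L (n + 1) / sqNorm L n) * orthoPoly L n) * orthoPoly L j =
          X * orthoPoly L (n + 1) * orthoPoly L j - orthoPoly L (n + 2) * orthoPoly L j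
          - c • (orthoPoly L (n + 1) * orthoPoly L j)
          - (sqNorm L (n + 1) / sqNorm L n) • (orthoPoly L n * orthoPoly L j) := by
        simp only [smul_eq_C_mul]; ring
      rw [e, map_sub, map_sub, map_sub, map_smul, map_smul,
        orthoPoly_mul_eq_zero_of_lt hL (by omega : j < n + 2),
        orthoPoly_mul_eq_zero_of_lt hL (by omega : j < n + 1)]
      rcases (Nat.lt_succ_iff.1 hj).eq_or_lt with rfl | hj'
      · rw [X_mul_orthoPoly_succ_mul hL, ← sqNorm, smul_eq_mul, smul_eq_mul,
          div_mul_cancel₀ _ (sqNorm_pos hL j).ne']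
        ring
      · rw [orthoPoly_mul_eq_zero_of_lt hL hj', mul_comm X, mul_assoc,
          orthoPoly_mul_eq_zero hL ((degree_X_mul_lt (degree_orthoPoly_lt L j)).trans_le
            (by exact_mod_cast (by omega)))]
        simp
  linear_combination -key

/-- The Christoffel-Darboux kernel on the diagonal. -/
def diagKernel (L : ℝ[X] →ₗ[ℝ] ℝ) (n : ℕ) (x : ℝ) : ℝ :=
  ∑ j ∈ Finset.range n, (orthoPoly L j).eval x ^ 2 / sqNorm L j

/-- The confluent Christoffel-Darboux formula. -/
theorem diagKernel_succ_mul (hL : PosDefFunctional L) (n : ℕ) (x : ℝ) :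
    diagKernel L (n + 1) x * sqNorm L n =
      (derivative (orthoPoly L (n + 1))).eval x * (orthoPoly L n).eval x
      - (orthoPoly L (n + 1)).eval x * (derivative (orthoPoly L n)).eval x := by
  induction n with
  | zero =>
    have h1 : orthoPoly L 1 = X + C ((orthoPoly L 1).coeff 0) := by
      conv_lhs => rw [(monic_orthoPoly L 1).eq_X_add_C (natDegree_orthoPoly L 1)]
    rw [h1]
    simp [diagKernel, orthoPoly_zero, (sqNorm_pos hL 0).ne']
  | succ n ih =>
    -- In the Wronskian of `p_{n+2}` and `p_{n+1}` the recurrence leaves `p_{n+1}²` plus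
    -- `h_{n+1}/h_n` times the previous Wronskian.
    obtain ⟨a, ha⟩ := orthoPoly_add_two hL n
    rw [diagKernel, Finset.sum_range_succ, ← diagKernel, add_mul,
      div_mul_cancel₀ _ (sqNorm_pos hL _).ne', ha]
    have h0 := (sqNorm_pos hL n).ne'
    simp only [derivative_sub, derivative_mul, derivative_X, derivative_C, eval_sub, eval_add,
      eval_mul, eval_X, eval_C, sub_zero, zero_mul, zero_add, one_mul]
    have : diagKernel L (n + 1) x = (diagKernel L (n + 1) x * sqNorm L n) / sqNorm L n := by
      field_simp
    rw [this, ih]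
    field_simp
    ring

/-- The Christoffel-Darboux kernel as a polynomial in its second variable. -/
def kernelPoly (L : ℝ[X] →ₗ[ℝ] ℝ) (n : ℕ) (x : ℝ) : ℝ[X] :=
  ∑ j ∈ Finset.range n, ((orthoPoly L j).eval x / sqNorm L j) • orthoPoly L j

theorem degree_kernelPoly_lt (n : ℕ) (x : ℝ) : (kernelPoly L n x).degree < n := by
  rw [← mem_degreeLT]
  refine Submodule.sum_mem _ fun j hj => Submodule.smul_mem _ _ (mem_degreeLT.2 ?_)
  rw [degree_orthoPoly]
  exact_mod_cast Finset.mem_range.1 hj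

theorem eval_kernelPoly (n : ℕ) (x : ℝ) : (kernelPoly L n x).eval x = diagKernel L n x := by
  simp only [kernelPoly, diagKernel, eval_finsetSum, eval_smul, smul_eq_mul]
  exact Finset.sum_congr rfl fun j _ => by ring

theorem kernelPoly_mul_orthoPoly (hL : PosDefFunctional L) {n j : ℕ} (hj : j < n) (x : ℝ) :
    L (kernelPoly L n x * orthoPoly L j) = (orthoPoly L j).eval x := by
  rw [kernelPoly, Finset.sum_mul, map_sum, Finset.sum_eq_single_of_mem j (Finset.mem_range.2 hj)]
  · rw [smul_mul_assoc, map_smul, smul_eq_mul, ← sqNorm, div_mul_cancel₀ _ (sqNorm_pos hL j).ne']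
  · intro i _ hij
    rw [smul_mul_assoc, map_smul]
    rcases hij.lt_or_gt with h | h
    · rw [mul_comm, orthoPoly_mul_eq_zero_of_lt hL h, smul_zero]
    · rw [orthoPoly_mul_eq_zero_of_lt hL h, smul_zero]

end OrthogonalPolynomials

/-! ### An algebra of functions with symmetric mixed derivatives. -/

/-- On `U`, the function `f` of `(ξ, t)` has both partial derivatives and both mixed second
partial derivatives, and the latter agree. -/
def MixedDiff (U : Set (ℝ × ℝ)) (f : ℝ → ℝ → ℝ) : Prop :=
  ∃ fx ft fm : ℝ → ℝ → ℝ, ∀ p ∈ U,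
    HasPartialXi f fx p ∧ HasPartialT f ft p ∧ HasPartialT fx fm p ∧ HasPartialXi ft fm p

section Partial

variable {U : Set (ℝ × ℝ)}

theorem eventually_mem_xi (hU : IsOpen U) {p : ℝ × ℝ} (hp : p ∈ U) :
    ∀ᶠ x in 𝓝 p.1, (x, p.2) ∈ U :=
  (Continuous.prodMk_left p.2).continuousAt.preimage_mem_nhds (hU.mem_nhds hp)

theorem eventually_mem_t (hU : IsOpen U) {p : ℝ × ℝ} (hp : p ∈ U) :
    ∀ᶠ s in 𝓝 p.2, (p.1, s) ∈ U :=
  (Continuous.prodMk_right p.1).continuousAt.preimage_mem_nhds (hU.mem_nhds hp)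

theorem HasPartialXi.congr_on (hU : IsOpen U) {f g f' g' : ℝ → ℝ → ℝ} {p : ℝ × ℝ} (hp : p ∈ U)
    (h : HasPartialXi f f' p) (hf : ∀ q ∈ U, g q.1 q.2 = f q.1 q.2)
    (hf' : g' p.1 p.2 = f' p.1 p.2) : HasPartialXi g g' p := by
  rw [HasPartialXi, hf']
  refine HasDerivAt.congr_of_eventuallyEq h ?_
  filter_upwards [eventually_mem_xi hU hp] with x hx using hf _ hx

theorem HasPartialT.congr_on (hU : IsOpen U) {f g f' g' : ℝ → ℝ → ℝ} {p : ℝ × ℝ} (hp : p ∈ U)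
    (h : HasPartialT f f' p) (hf : ∀ q ∈ U, g q.1 q.2 = f q.1 q.2)
    (hf' : g' p.1 p.2 = f' p.1 p.2) : HasPartialT g g' p := by
  rw [HasPartialT, hf']
  refine HasDerivAt.congr_of_eventuallyEq h ?_
  filter_upwards [eventually_mem_t hU hp] with x hx using hf _ hx

namespace MixedDiff

theorem congr_on (hU : IsOpen U) {f g : ℝ → ℝ → ℝ} (hf : MixedDiff U f)
    (h : ∀ q ∈ U, g q.1 q.2 = f q.1 q.2) : MixedDiff U g := by
  obtain ⟨fx, ft, fm, H⟩ := hf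
  exact ⟨fx, ft, fm, fun p hp => ⟨(H p hp).1.congr_on hU hp h rfl,
    (H p hp).2.1.congr_on hU hp h rfl, (H p hp).2.2⟩⟩

theorem exists_partialXi {f : ℝ → ℝ → ℝ} (hf : MixedDiff U f) :
    ∃ fx : ℝ → ℝ → ℝ, ∀ p ∈ U, HasPartialXi f fx p := by
  obtain ⟨fx, ft, fm, H⟩ := hf
  exact ⟨fx, fun p hp => (H p hp).1⟩

/-- If the second partial derivative in the order `t`, `ξ` is `g`, so is the one in the order
`ξ`, `t`. -/
theorem hasPartialT (hU : IsOpen U) {f fx ft g : ℝ → ℝ → ℝ} (hf : MixedDiff U f)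
    (hx : ∀ p ∈ U, HasPartialXi f fx p) (ht : ∀ p ∈ U, HasPartialT f ft p)
    (hg : ∀ p ∈ U, HasPartialXi ft g p) {p : ℝ × ℝ} (hp : p ∈ U) : HasPartialT fx g p := by
  obtain ⟨fx', ft', fm, H⟩ := hf
  have h1 : ∀ q ∈ U, fx q.1 q.2 = fx' q.1 q.2 := fun q hq => (hx q hq).unique (H q hq).1
  have h2 : ∀ q ∈ U, ft' q.1 q.2 = ft q.1 q.2 := fun q hq => ((H q hq).2.1).unique (ht q hq)
  have h3 : HasPartialXi ft' g p := (hg p hp).congr_on hU hp h2 rfl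
  exact (H p hp).2.2.1.congr_on hU hp h1 (h3.unique (H p hp).2.2.2)

theorem const (c : ℝ) : MixedDiff U fun _ _ => c :=
  ⟨fun _ _ => 0, fun _ _ => 0, fun _ _ => 0, fun _ _ =>
    ⟨hasDerivAt_const _ _, hasDerivAt_const _ _, hasDerivAt_const _ _, hasDerivAt_const _ _⟩⟩

theorem coord : MixedDiff U fun x _ => x :=
  ⟨fun _ _ => 1, fun _ _ => 0, fun _ _ => 0, fun _ _ =>
    ⟨hasDerivAt_id _, hasDerivAt_const _ _, hasDerivAt_const _ _, hasDerivAt_const _ _⟩⟩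

theorem add {f g : ℝ → ℝ → ℝ} (hf : MixedDiff U f) (hg : MixedDiff U g) :
    MixedDiff U fun x s => f x s + g x s := by
  obtain ⟨fx, ft, fm, F⟩ := hf
  obtain ⟨gx, gt, gm, G⟩ := hg
  refine ⟨fun x s => fx x s + gx x s, fun x s => ft x s + gt x s, fun x s => fm x s + gm x s,
    fun p hp => ?_⟩
  obtain ⟨f1, f2, f3, f4⟩ := F p hp
  obtain ⟨g1, g2, g3, g4⟩ := G p hp
  exact ⟨HasDerivAt.add f1 g1, HasDerivAt.add f2 g2, HasDerivAt.add f3 g3, HasDerivAt.add f4 g4⟩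

theorem mul {f g : ℝ → ℝ → ℝ} (hf : MixedDiff U f) (hg : MixedDiff U g) :
    MixedDiff U fun x s => f x s * g x s := by
  obtain ⟨fx, ft, fm, F⟩ := hf
  obtain ⟨gx, gt, gm, G⟩ := hg
  refine ⟨fun x s => fx x s * g x s + f x s * gx x s, fun x s => ft x s * g x s + f x s * gt x s,
    fun x s => fm x s * g x s + fx x s * gt x s + (ft x s * gx x s + f x s * gm x s),
    fun p hp => ?_⟩
  obtain ⟨f1, f2, f3, f4⟩ := F p hp
  obtain ⟨g1, g2, g3, g4⟩ := G p hp
  refine ⟨HasDerivAt.mul f1 g1, HasDerivAt.mul f2 g2,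
    HasDerivAt.add (HasDerivAt.mul f3 g2) (HasDerivAt.mul f2 g3), ?_⟩
  have h := HasDerivAt.add (HasDerivAt.mul f4 g1) (HasDerivAt.mul f1 g4)
  unfold HasPartialXi
  refine h.congr_deriv ?_
  ring

theorem neg {f : ℝ → ℝ → ℝ} (hf : MixedDiff U f) : MixedDiff U fun x s => -f x s := by
  simpa using (const (-1)).mul hf

theorem sub {f g : ℝ → ℝ → ℝ} (hf : MixedDiff U f) (hg : MixedDiff U g) :
    MixedDiff U fun x s => f x s - g x s := by
  simpa [sub_eq_add_neg] using hf.add hg.neg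

theorem sum {ι : Type*} (I : Finset ι) {f : ι → ℝ → ℝ → ℝ} (hf : ∀ i ∈ I, MixedDiff U (f i)) :
    MixedDiff U fun x s => ∑ i ∈ I, f i x s := by
  classical
  induction I using Finset.induction_on with
  | empty => simpa using const 0
  | insert i I hi ih =>
    simp only [Finset.sum_insert hi]
    exact (hf i (Finset.mem_insert_self i I)).add
      (ih fun j hj => hf j (Finset.mem_insert_of_mem hj))

theorem pow {f : ℝ → ℝ → ℝ} (hf : MixedDiff U f) (k : ℕ) : MixedDiff U fun x s => f x s ^ k := by
  induction k with
  | zero => simpa using const 1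
  | succ k ih => simpa only [pow_succ] using ih.mul hf

theorem inv {f : ℝ → ℝ → ℝ} (hf : MixedDiff U f) (h0 : ∀ p ∈ U, f p.1 p.2 ≠ 0) :
    MixedDiff U fun x s => (f x s)⁻¹ := by
  obtain ⟨fx, ft, fm, F⟩ := hf
  refine ⟨fun x s => -fx x s / f x s ^ 2, fun x s => -ft x s / f x s ^ 2,
    fun x s => -fm x s / f x s ^ 2 + 2 * fx x s * ft x s / f x s ^ 3, fun p hp => ?_⟩
  obtain ⟨f1, f2, f3, f4⟩ := F p hp
  have hp0 := h0 p hp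
  refine ⟨HasDerivAt.inv f1 hp0, HasDerivAt.inv f2 hp0, ?_, ?_⟩
  · have h := HasDerivAt.div (HasDerivAt.neg f3) (HasDerivAt.pow f2 2) (pow_ne_zero 2 hp0)
    unfold HasPartialT
    refine h.congr_deriv ?_
    simp
    field_simp
  · have h := HasDerivAt.div (HasDerivAt.neg f4) (HasDerivAt.pow f1 2) (pow_ne_zero 2 hp0)
    unfold HasPartialXi
    refine h.congr_deriv ?_
    simp
    field_simp

theorem div {f g : ℝ → ℝ → ℝ} (hf : MixedDiff U f) (hg : MixedDiff U g)
    (h0 : ∀ p ∈ U, g p.1 p.2 ≠ 0) : MixedDiff U fun x s => f x s / g x s := by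
  simpa only [div_eq_mul_inv] using hf.mul (hg.inv h0)

theorem log {f : ℝ → ℝ → ℝ} (hf : MixedDiff U f) (h0 : ∀ p ∈ U, f p.1 p.2 ≠ 0) :
    MixedDiff U fun x s => Real.log (f x s) := by
  obtain ⟨fx, ft, fm, F⟩ := hf
  refine ⟨fun x s => fx x s / f x s, fun x s => ft x s / f x s,
    fun x s => fm x s / f x s - fx x s * ft x s / f x s ^ 2, fun p hp => ?_⟩
  obtain ⟨f1, f2, f3, f4⟩ := F p hp
  have hp0 := h0 p hp
  refine ⟨HasDerivAt.log f1 hp0, HasDerivAt.log f2 hp0, ?_, ?_⟩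
  · have h := HasDerivAt.div f3 f2 hp0
    unfold HasPartialT
    refine h.congr_deriv ?_
    field_simp
  · have h := HasDerivAt.div f4 f1 hp0
    unfold HasPartialXi
    refine h.congr_deriv ?_
    field_simp

end MixedDiff

end Partial

/-! ### Derivatives of orthogonal polynomials along a one-parameter deformation. -/

/-- The coefficients of the polynomials `P s`, of bounded degree, have at `s₀` the derivatives
given by the coefficients of `P'`. -/
def HasPolyDerivAt (P : ℝ → ℝ[X]) (P' : ℝ[X]) (s₀ : ℝ) : Prop :=
  (∀ k, HasDerivAt (fun s => (P s).coeff k) (P'.coeff k) s₀) ∧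
    ∃ N, (∀ s, (P s).natDegree < N) ∧ P'.natDegree < N

namespace HasPolyDerivAt

variable {P Q : ℝ → ℝ[X]} {P' Q' : ℝ[X]} {s₀ : ℝ}

theorem const (q : ℝ[X]) : HasPolyDerivAt (fun _ => q) 0 s₀ :=
  ⟨fun k => by simpa using hasDerivAt_const s₀ (q.coeff k), q.natDegree + 1, by simp, by simp⟩

theorem mul (hP : HasPolyDerivAt P P' s₀) (hQ : HasPolyDerivAt Q Q' s₀) :
    HasPolyDerivAt (fun s => P s * Q s) (P' * Q s₀ + P s₀ * Q') s₀ := by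
  obtain ⟨hP, N, hN, hN'⟩ := hP
  obtain ⟨hQ, M, hM, hM'⟩ := hQ
  refine ⟨fun k => ?_, N + M, fun s => ?_, ?_⟩
  · simp only [coeff_mul, coeff_add]
    rw [← Finset.sum_add_distrib]
    exact HasDerivAt.fun_sum fun i _ => (hP i.1).mul (hQ i.2)
  · have h1 : (P s * Q s).natDegree ≤ _ := natDegree_mul_le
    have := hN s
    have := hM s
    exact h1.trans_lt (by omega)
  · have h1 := natDegree_mul_le (p := P') (q := Q s₀)
    have h2 := natDegree_mul_le (p := P s₀) (q := Q')
    have h3 := natDegree_add_le (P' * Q s₀) (P s₀ * Q')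
    have := hN s₀
    have := hM s₀
    have : max (P' * Q s₀).natDegree (P s₀ * Q').natDegree < N + M := max_lt (by omega) (by omega)
    omega

theorem momentFunctional (hP : HasPolyDerivAt P P' s₀) {μ : ℝ → ℕ → ℝ} {μ' : ℕ → ℝ}
    (hμ : ∀ k, HasDerivAt (fun s => μ s k) (μ' k) s₀) :
    HasDerivAt (fun s => momentFunctional (μ s) (P s))
      (UnitaryEnsemble.momentFunctional μ' (P s₀) +
        UnitaryEnsemble.momentFunctional (μ s₀) P') s₀ := by
  obtain ⟨hP, N, hN, hN'⟩ := hP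
  rw [momentFunctional_eq_sum μ' (hN s₀), momentFunctional_eq_sum (μ s₀) hN',
    ← Finset.sum_add_distrib]
  simp only [fun s => momentFunctional_eq_sum (μ s) (hN s)]
  refine HasDerivAt.fun_sum fun k _ => ((hP k).mul (hμ k)).congr_deriv ?_
  ring

theorem eval (hP : HasPolyDerivAt P P' s₀) {x : ℝ → ℝ} {x' : ℝ} (hx : HasDerivAt x x' s₀) :
    HasDerivAt (fun s => (P s).eval (x s))
      (P'.eval (x s₀) + (derivative (P s₀)).eval (x s₀) * x') s₀ := by
  obtain ⟨hP, N, hN, hN'⟩ := hP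
  have h2 := ((P s₀).hasDerivAt (x s₀)).comp s₀ hx
  have h3 : HasDerivAt (fun s => ∑ k ∈ Finset.range N, (P s).coeff k * x s ^ k)
      (∑ k ∈ Finset.range N, (P'.coeff k * x s₀ ^ k +
        (P s₀).coeff k * ((k : ℝ) * x s₀ ^ (k - 1) * x'))) s₀ :=
    HasDerivAt.fun_sum fun k _ => (hP k).mul (hx.pow k)
  have h4 : HasDerivAt (fun s => ∑ k ∈ Finset.range N, (P s₀).coeff k * x s ^ k)
      (∑ k ∈ Finset.range N, (P s₀).coeff k * ((k : ℝ) * x s₀ ^ (k - 1) * x')) s₀ :=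
    HasDerivAt.fun_sum fun k _ => (hx.pow k).const_mul _
  -- `h2` and `h4` differentiate the same function, a fixed polynomial along `x s`, so the termwise
  -- sum is the chain-rule expression.
  have h5 := h2.unique (h4.congr_of_eventuallyEq (Eventually.of_forall fun s => by
    simp [eval_eq_sum_range' (hN s₀)]))
  simp only [fun s => eval_eq_sum_range' (hN s), eval_eq_sum_range' hN', h5]
  rwa [Finset.sum_add_distrib] at h3

end HasPolyDerivAt

section OneParameter

variable {μ : ℝ → ℕ → ℝ} {μ' : ℕ → ℝ} {s₀ : ℝ}

/-- The leading coefficient is constantly `1`, so the derivative drops below degree `n`. This is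
what makes it orthogonal to `p_n` later. -/
theorem exists_hasPolyDerivAt_orthoPoly {L : ℝ → ℝ[X] →ₗ[ℝ] ℝ} {n : ℕ}
    (h : ∀ k, DifferentiableAt ℝ (fun s => (orthoPoly (L s) n).coeff k) s₀) :
    ∃ P' : ℝ[X], P'.degree < n ∧ HasPolyDerivAt (fun s => orthoPoly (L s) n) P' s₀ := by
  set P' : ℝ[X] := ∑ k ∈ Finset.range n,
    monomial k (deriv (fun s => (orthoPoly (L s) n).coeff k) s₀) with hP'
  have hc : ∀ k, P'.coeff k =
      if k < n then deriv (fun s => (orthoPoly (L s) n).coeff k) s₀ else 0 := by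
    intro k
    simp [hP', coeff_monomial]
  have hd : P'.degree < n := by
    rw [degree_lt_iff_coeff_zero]
    intro k hk
    rw [hc, if_neg (by omega)]
  refine ⟨P', hd, fun k => ?_, n + 1, fun s => ?_, ?_⟩
  · rw [hc]
    split_ifs with hk
    · exact (h k).hasDerivAt
    · rcases (not_lt.1 hk).eq_or_lt with rfl | hk
      · simpa [coeff_orthoPoly_self] using hasDerivAt_const s₀ (1 : ℝ)
      · have : ∀ s, (orthoPoly (L s) n).coeff k = 0 := fun s =>
          coeff_eq_zero_of_natDegree_lt (by rwa [natDegree_orthoPoly])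
        simpa [this] using hasDerivAt_const s₀ (0 : ℝ)
  · rw [natDegree_orthoPoly]; omega
  · rcases eq_or_ne P' 0 with h0 | h0
    · simp [h0]
    · exact ((natDegree_lt_iff_degree_lt h0).2 hd).trans n.lt_succ_self

/-- Obtained by differentiating the relation `L(p_n q) = 0`, valid for all nearby parameters with
`q` fixed. -/
theorem momentFunctional_deriv_orthoPoly_mul
    (hμ : ∀ k, HasDerivAt (fun s => μ s k) (μ' k) s₀)
    (hpos : ∀ᶠ s in 𝓝 s₀, PosDefFunctional (momentFunctional (μ s))) {n : ℕ} {P' : ℝ[X]}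
    (hP' : HasPolyDerivAt (fun s => orthoPoly (momentFunctional (μ s)) n) P' s₀)
    {q : ℝ[X]} (hq : q.degree < n) :
    momentFunctional (μ s₀) (P' * q) =
      -momentFunctional μ' (orthoPoly (momentFunctional (μ s₀)) n * q) := by
  have h := (hP'.mul (HasPolyDerivAt.const q)).momentFunctional hμ
  have h0 : HasDerivAt (fun s => momentFunctional (μ s)
      (orthoPoly (momentFunctional (μ s)) n * q)) 0 s₀ := by
    refine (hasDerivAt_const s₀ (0 : ℝ)).congr_of_eventuallyEq ?_
    filter_upwards [hpos] with s hs using orthoPoly_mul_eq_zero hs hq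
  have h1 := h.unique h0
  simp only [mul_zero, add_zero] at h1
  linarith

/-- The variation of `p_n` has degree below `n`, hence is orthogonal to `p_n`; to first order only
the functional varies. -/
theorem hasDerivAt_sqNorm
    (hμ : ∀ k, HasDerivAt (fun s => μ s k) (μ' k) s₀)
    (hpos : PosDefFunctional (momentFunctional (μ s₀))) {n : ℕ} {P' : ℝ[X]}
    (hP' : HasPolyDerivAt (fun s => orthoPoly (momentFunctional (μ s)) n) P' s₀)
    (hd : P'.degree < n) :
    HasDerivAt (fun s => sqNorm (momentFunctional (μ s)) n)
      (momentFunctional μ' (orthoPoly (momentFunctional (μ s₀)) n *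
        orthoPoly (momentFunctional (μ s₀)) n)) s₀ := by
  refine ((hP'.mul hP').momentFunctional hμ).congr_deriv ?_
  rw [map_add, mul_comm P', orthoPoly_mul_eq_zero hpos hd]
  ring

/-- Pairing the variation of `p_{n+1}`, of degree at most `n`, with `p_n` isolates its coefficient
of order `n`. -/
theorem hasDerivAt_coeff_orthoPoly_succ
    (hμ : ∀ k, HasDerivAt (fun s => μ s k) (μ' k) s₀)
    (hpos : ∀ᶠ s in 𝓝 s₀, PosDefFunctional (momentFunctional (μ s))) {n : ℕ} {P' : ℝ[X]}
    (hP' : HasPolyDerivAt (fun s => orthoPoly (momentFunctional (μ s)) (n + 1)) P' s₀)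
    (hd : P'.degree < ((n + 1 : ℕ) : WithBot ℕ)) :
    HasDerivAt (fun s => (orthoPoly (momentFunctional (μ s)) (n + 1)).coeff n)
      (-momentFunctional μ' (orthoPoly (momentFunctional (μ s₀)) (n + 1) *
        orthoPoly (momentFunctional (μ s₀)) n) / sqNorm (momentFunctional (μ s₀)) n) s₀ := by
  have h1 := momentFunctional_deriv_orthoPoly_mul hμ hpos hP'
    (degree_orthoPoly_lt (momentFunctional (μ s₀)) n)
  rw [mul_comm P', orthoPoly_mul_eq_coeff hpos.self_of_nhds hd] at h1
  rw [← h1, mul_div_cancel_right₀ _ (sqNorm_pos hpos.self_of_nhds n).ne']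
  exact hP'.1 n

end OneParameter

theorem momentFunctional_eq_mul_eval (r x : ℝ) (q : ℝ[X]) :
    momentFunctional (fun k => x ^ k * r) q = r * q.eval x := by
  rw [momentFunctional_eq_sum _ q.natDegree.lt_succ_self,
    eval_eq_sum_range' q.natDegree.lt_succ_self, Finset.mul_sum]
  exact Finset.sum_congr rfl fun k _ => by ring

theorem momentFunctional_X_pow_mul (μ : ℕ → ℝ) (n : ℕ) {q : ℝ[X]} {N : ℕ} (hq : q.natDegree < N) :
    momentFunctional μ (X ^ n * q) = ∑ k ∈ Finset.range N, q.coeff k * μ (n + k) := by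
  conv_lhs => rw [q.as_sum_range' N hq, Finset.mul_sum, map_sum]
  refine Finset.sum_congr rfl fun k _ => ?_
  rw [← C_mul_X_pow_eq_monomial, mul_left_comm, ← pow_add, ← smul_eq_C_mul, map_smul,
    momentFunctional_X_pow, smul_eq_mul]

theorem momentFunctional_shift (μ : ℕ → ℝ) (q : ℝ[X]) :
    momentFunctional (fun k => μ (k + 1)) q = momentFunctional μ (X * q) := by
  have h := momentFunctional_X_pow_mul μ 1 q.natDegree.lt_succ_self
  rw [pow_one] at h
  rw [h, momentFunctional_eq_sum _ q.natDegree.lt_succ_self]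
  exact Finset.sum_congr rfl fun k _ => by rw [add_comm]

/-! ### Moment families depending on an endpoint and the Toda time. -/

/-- On the open set `U`, the `μ k` are the moments of a positive definite functional depending
on `(ξ, t)` as the restriction of a weight `e^{tx}` to an interval with endpoint `ξ` does; `r`
is the (signed) weight at the endpoint. -/
structure IsMomentFamily (U : Set (ℝ × ℝ)) (μ : ℕ → ℝ → ℝ → ℝ) (r rx : ℝ → ℝ → ℝ) : Prop where
  isOpen : IsOpen U
  posDef : ∀ p ∈ U, PosDefFunctional (momentFunctional fun k => μ k p.1 p.2)
  moment_xi : ∀ p ∈ U, ∀ k, HasPartialXi (μ k) (fun x s => x ^ k * r x s) p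
  moment_t : ∀ p ∈ U, ∀ k, HasPartialT (μ k) (μ (k + 1)) p
  edge_xi : ∀ p ∈ U, HasPartialXi r rx p
  edge_t : ∀ p ∈ U, HasPartialT r (fun x s => x * r x s) p
  edge_xi_t : ∀ p ∈ U, HasPartialT rx (fun x s => r x s + x * rx x s) p

namespace IsMomentFamily

variable {U : Set (ℝ × ℝ)} {μ : ℕ → ℝ → ℝ → ℝ} {r rx : ℝ → ℝ → ℝ}

theorem mixedDiff_moment (H : IsMomentFamily U μ r rx) (k : ℕ) : MixedDiff U (μ k) :=
  ⟨fun x s => x ^ k * r x s, μ (k + 1), fun x s => x ^ (k + 1) * r x s, fun p hp =>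
    ⟨H.moment_xi p hp k, H.moment_t p hp k,
      (HasDerivAt.const_mul (p.1 ^ k) (H.edge_t p hp)).congr_deriv (by ring),
      H.moment_xi p hp (k + 1)⟩⟩

/-- `r_ξ` contains `V'` only as a factor independent of `t`, so `edge_xi_t` requires no second
derivative of `V`. -/
theorem mixedDiff_edge (H : IsMomentFamily U μ r rx) : MixedDiff U r :=
  ⟨rx, fun x s => x * r x s, fun x s => r x s + x * rx x s, fun p hp =>
    ⟨H.edge_xi p hp, H.edge_t p hp, H.edge_xi_t p hp,
      (HasDerivAt.mul (hasDerivAt_id p.1) (H.edge_xi p hp)).congr_deriv (by simp)⟩⟩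

/-- The monic orthogonal polynomials of the family. -/
def poly (μ : ℕ → ℝ → ℝ → ℝ) (n : ℕ) (x s : ℝ) : ℝ[X] :=
  orthoPoly (momentFunctional fun k => μ k x s) n

/-- The squared norms of the orthogonal polynomials of the family. -/
def norm (μ : ℕ → ℝ → ℝ → ℝ) (n : ℕ) (x s : ℝ) : ℝ :=
  sqNorm (momentFunctional fun k => μ k x s) n

theorem norm_pos (H : IsMomentFamily U μ r rx) (n : ℕ) {p : ℝ × ℝ} (hp : p ∈ U) :
    0 < norm μ n p.1 p.2 :=
  sqNorm_pos (H.posDef p hp) n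

/-- This is `h_n = L(x^n p_n)`, polynomial in the coefficients of `p_n` and the moments, so
regularity of the coefficients passes to the norms. -/
theorem norm_eq_sum (H : IsMomentFamily U μ r rx) (n : ℕ) {p : ℝ × ℝ} (hp : p ∈ U) :
    norm μ n p.1 p.2 =
      ∑ k ∈ Finset.range (n + 1), (poly μ n p.1 p.2).coeff k * μ (n + k) p.1 p.2 := by
  rw [poly, ← momentFunctional_X_pow_mul (fun k => μ k p.1 p.2) n
    (by rw [natDegree_orthoPoly]; omega), mul_comm,
    orthoPoly_mul_eq_coeff (H.posDef p hp) (by rw [degree_X_pow]; exact_mod_cast n.lt_succ_self),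
    coeff_X_pow_self, one_mul, norm]

/-- Gram-Schmidt builds the coefficients of `p_n` rationally from moments and from lower `p_i`, with
only the positive norms as denominators. -/
theorem mixedDiff_coeff (H : IsMomentFamily U μ r rx) (n : ℕ) :
    ∀ k, MixedDiff U fun x s => (poly μ n x s).coeff k := by
  induction n using Nat.strong_induction_on with
  | _ n ih =>
    intro k
    have hnorm : ∀ i < n, MixedDiff U (norm μ i) := fun i hi =>
      MixedDiff.congr_on H.isOpen (MixedDiff.sum (Finset.range (i + 1)) fun k _ =>
        (ih i hi k).mul (H.mixedDiff_moment (i + k))) fun p hp => H.norm_eq_sum i hp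
    refine MixedDiff.congr_on H.isOpen ((MixedDiff.const ((X ^ n : ℝ[X]).coeff k)).sub
      (MixedDiff.sum (Finset.range n) (f := fun i x s => (∑ j ∈ Finset.range (i + 1),
        (poly μ i x s).coeff j * μ (n + j) x s) / norm μ i x s * (poly μ i x s).coeff k)
        fun i hi => ?_)) fun p hp => ?_
    · have hi := Finset.mem_range.1 hi
      exact ((MixedDiff.sum _ fun j _ => (ih i hi j).mul (H.mixedDiff_moment (n + j))).div
        (hnorm i hi) fun p hp => (H.norm_pos i hp).ne').mul (ih i hi k)
    · simp only [poly, norm]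
      conv_lhs => rw [orthoPoly_eq]
      rw [coeff_sub, finsetSum_coeff]
      congr 1
      refine Finset.sum_congr rfl fun i _ => ?_
      rw [coeff_C_mul, momentFunctional_X_pow_mul (fun k => μ k p.1 p.2) n (N := i + 1)
        (by rw [natDegree_orthoPoly]; omega)]

theorem mixedDiff_norm (H : IsMomentFamily U μ r rx) (n : ℕ) : MixedDiff U (norm μ n) :=
  MixedDiff.congr_on H.isOpen (MixedDiff.sum (Finset.range (n + 1)) fun k _ =>
    (H.mixedDiff_coeff n k).mul (H.mixedDiff_moment (n + k))) fun _ hp => H.norm_eq_sum n hp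

/-- The orthogonal polynomials evaluated at the endpoint. -/
def edgeVal (μ : ℕ → ℝ → ℝ → ℝ) (n : ℕ) (x s : ℝ) : ℝ := (poly μ n x s).eval x

/-- The derivatives of the orthogonal polynomials evaluated at the endpoint. -/
def edgeDeriv (μ : ℕ → ℝ → ℝ → ℝ) (n : ℕ) (x s : ℝ) : ℝ := (derivative (poly μ n x s)).eval x

/-- The Christoffel-Darboux kernel at the endpoint. -/
def edgeKernel (μ : ℕ → ℝ → ℝ → ℝ) (n : ℕ) (x s : ℝ) : ℝ :=
  ∑ j ∈ Finset.range n, edgeVal μ j x s ^ 2 / norm μ j x s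

theorem mixedDiff_edgeVal (H : IsMomentFamily U μ r rx) (n : ℕ) : MixedDiff U (edgeVal μ n) :=
  MixedDiff.congr_on H.isOpen (MixedDiff.sum (Finset.range (n + 1)) fun k _ =>
    (H.mixedDiff_coeff n k).mul (MixedDiff.coord.pow k)) fun p _ =>
      eval_eq_sum_range' (by rw [poly, natDegree_orthoPoly]; omega) _

theorem mixedDiff_edgeKernel (H : IsMomentFamily U μ r rx) (n : ℕ) :
    MixedDiff U (edgeKernel μ n) :=
  MixedDiff.sum _ fun j _ => ((H.mixedDiff_edgeVal j).pow 2).div (H.mixedDiff_norm j)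
    fun _ hp => (H.norm_pos j hp).ne'

theorem exists_deriv_poly_xi (H : IsMomentFamily U μ r rx) (n : ℕ) {p : ℝ × ℝ} (hp : p ∈ U) :
    ∃ P' : ℝ[X], P'.degree < n ∧ HasPolyDerivAt (fun x => poly μ n x p.2) P' p.1 :=
  exists_hasPolyDerivAt_orthoPoly (L := fun x => momentFunctional fun k => μ k x p.2) fun k => by
    obtain ⟨fx, ft, fm, h⟩ := H.mixedDiff_coeff n k
    exact HasDerivAt.differentiableAt (h p hp).1

theorem exists_deriv_poly_t (H : IsMomentFamily U μ r rx) (n : ℕ) {p : ℝ × ℝ} (hp : p ∈ U) :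
    ∃ P' : ℝ[X], P'.degree < n ∧ HasPolyDerivAt (fun s => poly μ n p.1 s) P' p.2 :=
  exists_hasPolyDerivAt_orthoPoly (L := fun s => momentFunctional fun k => μ k p.1 s) fun k => by
    obtain ⟨fx, ft, fm, h⟩ := H.mixedDiff_coeff n k
    exact HasDerivAt.differentiableAt (h p hp).2.1

theorem posDef_xi (H : IsMomentFamily U μ r rx) {p : ℝ × ℝ} (hp : p ∈ U) :
    ∀ᶠ x in 𝓝 p.1, PosDefFunctional (momentFunctional fun k => μ k x p.2) := by
  filter_upwards [eventually_mem_xi H.isOpen hp] with x hx using H.posDef _ hx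

theorem posDef_t (H : IsMomentFamily U μ r rx) {p : ℝ × ℝ} (hp : p ∈ U) :
    ∀ᶠ s in 𝓝 p.2, PosDefFunctional (momentFunctional fun k => μ k p.1 s) := by
  filter_upwards [eventually_mem_t H.isOpen hp] with x hx using H.posDef _ hx

theorem norm_xi (H : IsMomentFamily U μ r rx) (n : ℕ) {p : ℝ × ℝ} (hp : p ∈ U) :
    HasPartialXi (norm μ n) (fun x s => r x s * edgeVal μ n x s ^ 2) p := by
  obtain ⟨P', hd, hP'⟩ := H.exists_deriv_poly_xi n hp
  refine (hasDerivAt_sqNorm (μ := fun x k => μ k x p.2) (H.moment_xi p hp) (H.posDef p hp)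
    hP' hd).congr_deriv ?_
  rw [momentFunctional_eq_mul_eval, eval_mul, ← pow_two]
  rfl

/-- The coefficient of order `n` in `X * p_n` stands for the one of order `n - 1` in `p_n`, and is
correctly `0` when `n = 0`. -/
theorem norm_t (H : IsMomentFamily U μ r rx) (n : ℕ) {p : ℝ × ℝ} (hp : p ∈ U) :
    HasPartialT (norm μ n) (fun x s => ((X * poly μ n x s).coeff n -
      (poly μ (n + 1) x s).coeff n) * norm μ n x s) p := by
  obtain ⟨P', hd, hP'⟩ := H.exists_deriv_poly_t n hp
  refine (hasDerivAt_sqNorm (μ := fun s k => μ k p.1 s) (H.moment_t p hp) (H.posDef p hp)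
    hP' hd).congr_deriv ?_
  rw [momentFunctional_shift (fun k => μ k p.1 p.2), X_mul_orthoPoly_mul_self (H.posDef p hp)]
  rfl

theorem coeff_xi (H : IsMomentFamily U μ r rx) (n : ℕ) {p : ℝ × ℝ} (hp : p ∈ U) :
    HasPartialXi (fun x s => (poly μ (n + 1) x s).coeff n)
      (fun x s => -(r x s * edgeVal μ (n + 1) x s * edgeVal μ n x s / norm μ n x s)) p := by
  obtain ⟨P', hd, hP'⟩ := H.exists_deriv_poly_xi (n + 1) hp
  refine (hasDerivAt_coeff_orthoPoly_succ (μ := fun x k => μ k x p.2) (H.moment_xi p hp)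
    (H.posDef_xi hp) hP' hd).congr_deriv ?_
  rw [momentFunctional_eq_mul_eval, eval_mul, neg_div, ← mul_assoc]
  rfl

theorem coeff_t (H : IsMomentFamily U μ r rx) (n : ℕ) {p : ℝ × ℝ} (hp : p ∈ U) :
    HasPartialT (fun x s => (poly μ (n + 1) x s).coeff n)
      (fun x s => -(norm μ (n + 1) x s / norm μ n x s)) p := by
  obtain ⟨P', hd, hP'⟩ := H.exists_deriv_poly_t (n + 1) hp
  refine (hasDerivAt_coeff_orthoPoly_succ (μ := fun s k => μ k p.1 s) (H.moment_t p hp)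
    (H.posDef_t hp) hP' hd).congr_deriv ?_
  rw [momentFunctional_shift (fun k => μ k p.1 p.2), ← mul_assoc,
    X_mul_orthoPoly_succ_mul (H.posDef p hp), neg_div]
  rfl

/-- The variation of `p_n` pairs with each `p_j`, `j < n`, to `-r p_n(ξ) p_j(ξ)`, so by the
reproducing property it is `-r p_n(ξ)` times the Christoffel-Darboux kernel at `ξ`. The term
`edgeDeriv` comes from the motion of the evaluation point itself. -/
theorem edgeVal_xi (H : IsMomentFamily U μ r rx) (n : ℕ) {p : ℝ × ℝ} (hp : p ∈ U) :
    HasPartialXi (edgeVal μ n)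
      (fun x s => edgeDeriv μ n x s - r x s * edgeVal μ n x s * edgeKernel μ n x s) p := by
  obtain ⟨P', hd, hP'⟩ := H.exists_deriv_poly_xi n hp
  refine (hP'.eval (hasDerivAt_id p.1)).congr_deriv ?_
  set L := momentFunctional fun k => μ k p.1 p.2 with hL
  have hpos : PosDefFunctional L := H.posDef p hp
  have key : P' + (r p.1 p.2 * edgeVal μ n p.1 p.2) • kernelPoly L n p.1 = 0 := by
    refine eq_zero_of_forall_mul_orthoPoly hpos (n := n) ?_ fun j hj => ?_
    · rw [← mem_degreeLT] at hd ⊢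
      exact Submodule.add_mem _ hd
        (Submodule.smul_mem _ _ (mem_degreeLT.2 (degree_kernelPoly_lt n _)))
    · have h := momentFunctional_deriv_orthoPoly_mul (μ := fun x k => μ k x p.2)
        (H.moment_xi p hp) (H.posDef_xi hp) hP'
        (q := orthoPoly L j) (by rw [degree_orthoPoly]; exact_mod_cast hj)
      rw [momentFunctional_eq_mul_eval, eval_mul] at h
      rw [add_mul, map_add, smul_mul_assoc, map_smul, kernelPoly_mul_orthoPoly hpos hj,
        smul_eq_mul]
      have e : L (P' * orthoPoly L j) = _ := h
      rw [e, edgeVal, poly]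
      ring
  have h2 := congrArg (Polynomial.eval p.1) key
  rw [eval_add, eval_smul, eval_kernelPoly, smul_eq_mul, eval_zero] at h2
  have e1 : diagKernel L n p.1 = edgeKernel μ n p.1 p.2 := rfl
  rw [e1] at h2
  have e2 : (derivative (poly μ n p.1 p.2)).eval p.1 = edgeDeriv μ n p.1 p.2 := rfl
  simp only [id, mul_one, e2]
  linarith

theorem edgeKernel_mul_norm (H : IsMomentFamily U μ r rx) (n : ℕ) {p : ℝ × ℝ} (hp : p ∈ U) :
    edgeKernel μ (n + 1) p.1 p.2 * norm μ n p.1 p.2 =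
      edgeDeriv μ (n + 1) p.1 p.2 * edgeVal μ n p.1 p.2
        - edgeVal μ (n + 1) p.1 p.2 * edgeDeriv μ n p.1 p.2 :=
  diagKernel_succ_mul (H.posDef p hp) n p.1

/-- The logarithm of the product of the first `n` squared norms. -/
def logNorm (μ : ℕ → ℝ → ℝ → ℝ) (n : ℕ) (x s : ℝ) : ℝ :=
  ∑ j ∈ Finset.range n, Real.log (norm μ j x s)

theorem mixedDiff_logNorm (H : IsMomentFamily U μ r rx) (n : ℕ) : MixedDiff U (logNorm μ n) :=
  MixedDiff.sum _ fun j _ => (H.mixedDiff_norm j).log fun _ hp => (H.norm_pos j hp).ne'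

theorem logNorm_xi (H : IsMomentFamily U μ r rx) (n : ℕ) {p : ℝ × ℝ} (hp : p ∈ U) :
    HasPartialXi (logNorm μ n) (fun x s => r x s * edgeKernel μ n x s) p := by
  refine (HasDerivAt.fun_sum fun j _ =>
    HasDerivAt.log (H.norm_xi j hp) (H.norm_pos j hp).ne').congr_deriv ?_
  simp only [edgeKernel, Finset.mul_sum]
  exact Finset.sum_congr rfl fun j _ => mul_div_assoc _ _ _

/-- Each `∂_t log h_j` is a diagonal recurrence coefficient, a difference of consecutive subleading
coefficients, and the sum telescopes. -/
theorem logNorm_t (H : IsMomentFamily U μ r rx) (n : ℕ) {p : ℝ × ℝ} (hp : p ∈ U) :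
    HasPartialT (logNorm μ (n + 1)) (fun x s => -(poly μ (n + 1) x s).coeff n) p := by
  refine (HasDerivAt.fun_sum fun j _ =>
    HasDerivAt.log (H.norm_t j hp) (H.norm_pos j hp).ne').congr_deriv ?_
  have h : ∀ j, ((X * poly μ j p.1 p.2).coeff j - (poly μ (j + 1) p.1 p.2).coeff j) *
      norm μ j p.1 p.2 / norm μ j p.1 p.2 =
      (X * poly μ j p.1 p.2).coeff j - (X * poly μ (j + 1) p.1 p.2).coeff (j + 1) := fun j => by
    rw [mul_div_cancel_right₀ _ (H.norm_pos j hp).ne', coeff_X_mul]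
  simp only [h]
  rw [Finset.sum_range_sub']
  simp [coeff_X_mul]

end IsMomentFamily

/-! ### The universal PDE for moment families. -/

/-- The bracket equals `rK(P + Q)` with `P = ru²/h`, `Q = rgv²/h²`: all terms in `rx` cancel,
`2(ruv/h)³` absorbs the variation of the polynomials and norms, and `hK` replaces the Wronskian by
`Kh`. The right side is `(rK)²(4PQ + (P - Q)²)`. -/
theorem edge_wronskian_identity {r rx u v ud vd h g K : ℝ} (h0 : h ≠ 0)
    (hK : K * h = ud * v - u * vd) :
    (r * u * v / h * (((rx * u ^ 2 + r * (2 * u * (ud - r * u * K))) * h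
        - g * (rx * v ^ 2 + r * (2 * v * (vd - r * v * (K - v ^ 2 / h))))) / h ^ 2
        - 2 * (r * u ^ 2 * h - g * (r * v ^ 2)) * (r * v ^ 2) / h ^ 3)
      - (r * u ^ 2 * h - g * (r * v ^ 2)) / h ^ 2 *
        (((rx * u + r * (ud - r * u * K)) * v + r * u * (vd - r * v * (K - v ^ 2 / h))) / h
          - r * u * v * (r * v ^ 2) / h ^ 2)
      + 2 * (r * u * v / h) ^ 3) ^ 2 =
    (r * K) ^ 2 * (4 * (g / h) * (r * u * v / h) ^ 2 +
      ((r * u ^ 2 * h - g * (r * v ^ 2)) / h ^ 2) ^ 2) := by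
  have key : (r * u * v / h * (((rx * u ^ 2 + r * (2 * u * (ud - r * u * K))) * h
        - g * (rx * v ^ 2 + r * (2 * v * (vd - r * v * (K - v ^ 2 / h))))) / h ^ 2
        - 2 * (r * u ^ 2 * h - g * (r * v ^ 2)) * (r * v ^ 2) / h ^ 3)
      - (r * u ^ 2 * h - g * (r * v ^ 2)) / h ^ 2 *
        (((rx * u + r * (ud - r * u * K)) * v + r * u * (vd - r * v * (K - v ^ 2 / h))) / h
          - r * u * v * (r * v ^ 2) / h ^ 2)
      + 2 * (r * u * v / h) ^ 3) = r ^ 2 * K * (u ^ 2 * h + g * v ^ 2) / h ^ 2 := by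
    field_simp
    linear_combination (-r ^ 2 * h * (u ^ 2 * h + g * v ^ 2)) * hK
  rw [key]
  field_simp
  ring

namespace IsMomentFamily

variable {U : Set (ℝ × ℝ)} {μ : ℕ → ℝ → ℝ → ℝ} {r rx : ℝ → ℝ → ℝ}

/-- The partial derivatives of `ln τ_n` and the universal PDE, for a family of moments. -/
theorem exists_partials_succ (H : IsMomentFamily U μ r rx) (n : ℕ) :
    ∃ Tξ Tt Tξξ Tξt Ttt Tξξt Tξtt Tξξtt : ℝ → ℝ → ℝ, ∀ p ∈ U,
      HasPartialXi (logNorm μ (n + 1)) Tξ p ∧ HasPartialT (logNorm μ (n + 1)) Tt p ∧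
      HasPartialXi Tξ Tξξ p ∧ HasPartialT Tξ Tξt p ∧ HasPartialXi Tt Tξt p ∧
      HasPartialT Tt Ttt p ∧ HasPartialT Tξξ Tξξt p ∧ HasPartialXi Tξt Tξξt p ∧
      HasPartialT Tξt Tξtt p ∧ HasPartialXi Ttt Tξtt p ∧ HasPartialT Tξξt Tξξtt p ∧
      HasPartialXi Tξtt Tξξtt p ∧
      (Tξt p.1 p.2 * Tξξtt p.1 p.2 - Tξtt p.1 p.2 * Tξξt p.1 p.2 + 2 * Tξt p.1 p.2 ^ 3) ^ 2 =
        Tξ p.1 p.2 ^ 2 * (4 * Ttt p.1 p.2 * Tξt p.1 p.2 ^ 2 + Tξtt p.1 p.2 ^ 2) := by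
  set K := edgeKernel μ (n + 1)
  set u := edgeVal μ (n + 1)
  set v := edgeVal μ n
  set ud := edgeDeriv μ (n + 1)
  set vd := edgeDeriv μ n
  set h := norm μ n
  set g := norm μ (n + 1)
  have h0 : ∀ p ∈ U, h p.1 p.2 ≠ 0 := fun p hp => (H.norm_pos n hp).ne'
  have hK : ∀ x s, edgeKernel μ n x s = K x s - v x s ^ 2 / h x s := fun x s => by
    simp [K, edgeKernel, Finset.sum_range_succ, v, h]
  have hu : ∀ p ∈ U, HasPartialXi u (fun x s => ud x s - r x s * u x s * K x s) p :=
    fun p hp => H.edgeVal_xi (n + 1) hp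
  have hv : ∀ p ∈ U, HasPartialXi v
      (fun x s => vd x s - r x s * v x s * (K x s - v x s ^ 2 / h x s)) p := fun p hp => by
    simp only [← hK]
    exact H.edgeVal_xi n hp
  set Tx : ℝ → ℝ → ℝ := fun x s => r x s * K x s
  set A : ℝ → ℝ → ℝ := fun x s => r x s * u x s * v x s / h x s
  set R : ℝ → ℝ → ℝ := fun x s => g x s / h x s
  set B : ℝ → ℝ → ℝ := fun x s =>
    (r x s * u x s ^ 2 * h x s - g x s * (r x s * v x s ^ 2)) / h x s ^ 2
  set Ax : ℝ → ℝ → ℝ := fun x s =>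
    ((rx x s * u x s + r x s * (ud x s - r x s * u x s * K x s)) * v x s
      + r x s * u x s * (vd x s - r x s * v x s * (K x s - v x s ^ 2 / h x s))) / h x s
      - r x s * u x s * v x s * (r x s * v x s ^ 2) / h x s ^ 2 with hAx
  set Bx : ℝ → ℝ → ℝ := fun x s =>
    ((rx x s * u x s ^ 2 + r x s * (2 * u x s * (ud x s - r x s * u x s * K x s))) * h x s
      - g x s * (rx x s * v x s ^ 2
        + r x s * (2 * v x s * (vd x s - r x s * v x s * (K x s - v x s ^ 2 / h x s)))))
        / h x s ^ 2
      - 2 * (r x s * u x s ^ 2 * h x s - g x s * (r x s * v x s ^ 2)) * (r x s * v x s ^ 2)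
        / h x s ^ 3 with hBx
  set Tt : ℝ → ℝ → ℝ := fun x s => -(poly μ (n + 1) x s).coeff n
  have mTx : MixedDiff U Tx := H.mixedDiff_edge.mul (H.mixedDiff_edgeKernel _)
  have mTt : MixedDiff U Tt := (H.mixedDiff_coeff (n + 1) n).neg
  have mA : MixedDiff U A :=
    ((H.mixedDiff_edge.mul (H.mixedDiff_edgeVal _)).mul (H.mixedDiff_edgeVal _)).div
      (H.mixedDiff_norm n) h0
  -- No formula for `T_ξξ` is needed: its `t`-derivative follows from `T_ξt` by symmetry.
  obtain ⟨Txx, hTxx⟩ := mTx.exists_partialXi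
  have dTx : ∀ p ∈ U, HasPartialXi (logNorm μ (n + 1)) Tx p := fun p hp => H.logNorm_xi _ hp
  have dTt : ∀ p ∈ U, HasPartialT (logNorm μ (n + 1)) Tt p := fun p hp => H.logNorm_t _ hp
  have dTtx : ∀ p ∈ U, HasPartialXi Tt A p := fun p hp =>
    (HasDerivAt.neg (H.coeff_xi n hp)).congr_deriv (neg_neg _)
  have dTtt : ∀ p ∈ U, HasPartialT Tt R p := fun p hp =>
    (HasDerivAt.neg (H.coeff_t n hp)).congr_deriv (neg_neg _)
  have dRx : ∀ p ∈ U, HasPartialXi R B p := fun p hp =>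
    HasDerivAt.div (H.norm_xi (n + 1) hp) (H.norm_xi n hp) (h0 p hp)
  -- The `t`-derivative of `K` is never computed directly; the easier order, first `t` and then `ξ`,
  -- is transferred by symmetry.
  have dTxt : ∀ p ∈ U, HasPartialT Tx A p := fun p hp =>
    (H.mixedDiff_logNorm _).hasPartialT H.isOpen dTx dTt dTtx hp
  have dAt : ∀ p ∈ U, HasPartialT A B p := fun p hp =>
    mTt.hasPartialT H.isOpen dTtx dTtt dRx hp
  have dAx : ∀ p ∈ U, HasPartialXi A Ax p := fun p hp => by
    have hp0 := h0 p hp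
    refine (HasDerivAt.div (((H.edge_xi p hp).fun_mul (hu p hp)).fun_mul (hv p hp))
      (H.norm_xi n hp) hp0).congr_deriv ?_
    simp only [hAx]
    have e : norm μ n p.1 p.2 = h p.1 p.2 := rfl
    have e2 : edgeVal μ n p.1 p.2 = v p.1 p.2 := rfl
    simp only [e, e2]
    field_simp
  have dBx : ∀ p ∈ U, HasPartialXi B Bx p := fun p hp => by
    have hp0 := h0 p hp
    have hh := H.norm_xi n hp
    have hg := H.norm_xi (n + 1) hp
    have hr := H.edge_xi p hp
    refine (HasDerivAt.div (((hr.fun_mul ((hu p hp).fun_pow 2)).fun_mul hh).fun_sub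
      (hg.fun_mul (hr.fun_mul ((hv p hp).fun_pow 2)))) (hh.fun_pow 2)
      (pow_ne_zero 2 hp0)).congr_deriv ?_
    simp only [hBx]
    have e : norm μ n p.1 p.2 = h p.1 p.2 := rfl
    have e' : norm μ (n + 1) p.1 p.2 = g p.1 p.2 := rfl
    have e2 : edgeVal μ n p.1 p.2 = v p.1 p.2 := rfl
    have e3 : edgeVal μ (n + 1) p.1 p.2 = u p.1 p.2 := rfl
    simp only [e, e', e2, e3]
    field_simp
    ring
  refine ⟨Tx, Tt, Txx, A, R, Ax, B, Bx, fun p hp => ⟨dTx p hp, dTt p hp, hTxx p hp, dTxt p hp,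
    dTtx p hp, dTtt p hp, mTx.hasPartialT H.isOpen hTxx dTxt dAx hp, dAx p hp, dAt p hp,
    dRx p hp, mA.hasPartialT H.isOpen dAx dAt dBx hp, dBx p hp, ?_⟩⟩
  exact edge_wronskian_identity (h0 p hp) (H.edgeKernel_mul_norm n hp)

theorem exists_partials (H : IsMomentFamily U μ r rx) (n : ℕ) {T : ℝ → ℝ → ℝ}
    (hT : ∀ p ∈ U, T p.1 p.2 = logNorm μ n p.1 p.2) :
    ∃ Tξ Tt Tξξ Tξt Ttt Tξξt Tξtt Tξξtt : ℝ → ℝ → ℝ, ∀ p ∈ U,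
      HasPartialXi T Tξ p ∧ HasPartialT T Tt p ∧
      HasPartialXi Tξ Tξξ p ∧ HasPartialT Tξ Tξt p ∧ HasPartialXi Tt Tξt p ∧
      HasPartialT Tt Ttt p ∧ HasPartialT Tξξ Tξξt p ∧ HasPartialXi Tξt Tξξt p ∧
      HasPartialT Tξt Tξtt p ∧ HasPartialXi Ttt Tξtt p ∧ HasPartialT Tξξt Tξξtt p ∧
      HasPartialXi Tξtt Tξξtt p ∧
      (Tξt p.1 p.2 * Tξξtt p.1 p.2 - Tξtt p.1 p.2 * Tξξt p.1 p.2 + 2 * Tξt p.1 p.2 ^ 3) ^ 2 =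
        Tξ p.1 p.2 ^ 2 * (4 * Ttt p.1 p.2 * Tξt p.1 p.2 ^ 2 + Tξtt p.1 p.2 ^ 2) := by
  cases n with
  | zero =>
    -- For `n = 0` the sum of logarithms is empty, so `T` and all its derivatives vanish.
    have hx : ∀ p, HasPartialXi (fun _ _ => (0 : ℝ)) (fun _ _ => 0) p := fun p =>
      hasDerivAt_const _ _
    have ht : ∀ p, HasPartialT (fun _ _ => (0 : ℝ)) (fun _ _ => 0) p := fun p =>
      hasDerivAt_const _ _
    have hT' : ∀ p ∈ U, T p.1 p.2 = 0 := fun p hp => by rw [hT p hp]; simp [logNorm]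
    refine ⟨fun _ _ => 0, fun _ _ => 0, fun _ _ => 0, fun _ _ => 0, fun _ _ => 0, fun _ _ => 0,
      fun _ _ => 0, fun _ _ => 0, fun p hp => ⟨(hx p).congr_on H.isOpen hp hT' rfl,
      (ht p).congr_on H.isOpen hp hT' rfl, hx p, ht p, hx p, ht p, ht p, hx p, ht p, hx p,
      ht p, hx p, by ring⟩⟩
  | succ n =>
    obtain ⟨Tξ, Tt, Tξξ, Tξt, Ttt, Tξξt, Tξtt, Tξξtt, h⟩ := H.exists_partials_succ n
    exact ⟨Tξ, Tt, Tξξ, Tξt, Ttt, Tξξt, Tξtt, Tξξtt, fun p hp =>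
      ⟨(h p hp).1.congr_on H.isOpen hp hT rfl, (h p hp).2.1.congr_on H.isOpen hp hT rfl,
        (h p hp).2.2⟩⟩

end IsMomentFamily

/-! ### Moments of the weight and their dependence on the Toda time. -/

section Weight

variable {V : ℝ → ℝ} {S : Set ℝ} {E : Set ℝ} {s : ℝ}

theorem weight_nonneg (V : ℝ → ℝ) (S : Set ℝ) (s x : ℝ) : 0 ≤ weight V S s x :=
  Set.indicator_nonneg (fun _ _ => (Real.exp_pos _).le) x

theorem weight_of_mem {x : ℝ} (hx : x ∈ S) : weight V S s x = Real.exp (-V x + s * x) :=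
  Set.indicator_of_mem hx _

theorem weight_eq_mul_exp (V : ℝ → ℝ) (S : Set ℝ) (s s' x : ℝ) :
    weight V S s x = weight V S s' x * Real.exp ((s - s') * x) := by
  by_cases hx : x ∈ S
  · rw [weight_of_mem hx, weight_of_mem hx, ← Real.exp_add]
    ring_nf
  · simp [weight, hx]

/-- The measure with density `e^{-V}` on `E`. -/
def baseMeasure (V : ℝ → ℝ) (S E : Set ℝ) : Measure ℝ :=
  (volume.restrict E).withDensity fun x => ENNReal.ofReal (weight V S 0 x)

theorem aemeasurable_weight (h : ∀ᶠ s' in 𝓝 s, Integrable (weight V S s')) :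
    AEMeasurable (fun x => ENNReal.ofReal (weight V S 0 x)) (volume.restrict E) := by
  -- The weight need not be integrable at time `0`, but it is the weight at time `s` times an
  -- exponential, hence measurable.
  have h0 : AEMeasurable (weight V S 0) volume := by
    rw [funext (weight_eq_mul_exp V S 0 s)]
    exact h.self_of_nhds.aemeasurable.mul (by fun_prop)
  exact h0.restrict.ennreal_ofReal

theorem integrable_baseMeasure_iff (h : ∀ᶠ s' in 𝓝 s, Integrable (weight V S s')) (k : ℕ)
    (s' : ℝ) :
    Integrable (fun x : ℝ => x ^ k * Real.exp (s' * x)) (baseMeasure V S E) ↔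
      IntegrableOn (fun x => x ^ k * weight V S s' x) E := by
  rw [baseMeasure, integrable_withDensity_iff_integrable_smul₀' (aemeasurable_weight h)
    (Eventually.of_forall fun _ => ENNReal.ofReal_lt_top), IntegrableOn]
  refine iff_of_eq (congrArg (fun f => Integrable f _) (funext fun x => ?_))
  rw [ENNReal.toReal_ofReal (weight_nonneg _ _ _ _), smul_eq_mul, weight_eq_mul_exp V S s' 0,
    sub_zero]
  ring

/-- Integrability for all times near `s` makes `s` interior to the domain of the moment generating
function of `e^{-V}` on `E`. This gives all moments and differentiation under the integral. -/
theorem mem_interior_integrableExpSet (h : ∀ᶠ s' in 𝓝 s, Integrable (weight V S s')) :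
    s ∈ interior (ProbabilityTheory.integrableExpSet id (baseMeasure V S E)) := by
  rw [mem_interior_iff_mem_nhds]
  filter_upwards [h] with s' hs'
  have := (integrable_baseMeasure_iff (E := E) h 0 s').2 (by simpa using hs'.integrableOn)
  simpa [ProbabilityTheory.integrableExpSet] using this

theorem integrable_pow_mul_weight (h : ∀ᶠ s' in 𝓝 s, Integrable (weight V S s')) (k : ℕ) :
    Integrable fun x => x ^ k * weight V S s x := by
  have h1 := ProbabilityTheory.integrable_pow_mul_exp_of_mem_interior_integrableExpSet
    (mem_interior_integrableExpSet (E := Set.univ) h) k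
  have := (integrable_baseMeasure_iff (E := Set.univ) h k s).1 h1
  rwa [integrableOn_univ] at this

/-- The moments of the weight on `E`. -/
def weightMoment (V : ℝ → ℝ) (S E : Set ℝ) (k : ℕ) (s : ℝ) : ℝ := ∫ x in E, x ^ k * weight V S s x

theorem hasDerivAt_weightMoment (h : ∀ᶠ s' in 𝓝 s, Integrable (weight V S s')) (k : ℕ) :
    HasDerivAt (weightMoment V S E k) (weightMoment V S E (k + 1) s) s := by
  have key : ∀ j s', ∫ x : ℝ, x ^ j * Real.exp (s' * x) ∂(baseMeasure V S E) =
      weightMoment V S E j s' := fun j s' => by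
    rw [baseMeasure, integral_withDensity_eq_integral_toReal_smul₀ (aemeasurable_weight h)
      (Eventually.of_forall fun _ => ENNReal.ofReal_lt_top), weightMoment]
    refine integral_congr_ae (Eventually.of_forall fun x => ?_)
    simp only
    rw [ENNReal.toReal_ofReal (weight_nonneg _ _ _ _), smul_eq_mul, weight_eq_mul_exp V S s' 0,
      sub_zero]
    ring
  have h1 := ProbabilityTheory.hasDerivAt_integral_pow_mul_exp_real
    (mem_interior_integrableExpSet (E := E) h) k
  simp only [id, key] at h1
  exact h1

/-- Integration of polynomials against the weight on `E`. -/
def weightFunctional (V : ℝ → ℝ) (S E : Set ℝ) (s : ℝ) : ℝ[X] →ₗ[ℝ] ℝ :=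
  momentFunctional fun k => weightMoment V S E k s

theorem integrable_eval_mul_weight (h : ∀ᶠ s' in 𝓝 s, Integrable (weight V S s')) (q : ℝ[X]) :
    Integrable fun x => q.eval x * weight V S s x := by
  simp only [eval_eq_sum_range, Finset.sum_mul, mul_assoc]
  exact integrable_finsetSum _ fun k _ => (integrable_pow_mul_weight h k).const_mul _

theorem weightFunctional_apply (h : ∀ᶠ s' in 𝓝 s, Integrable (weight V S s')) (q : ℝ[X]) :
    weightFunctional V S E s q = ∫ x in E, q.eval x * weight V S s x := by
  rw [weightFunctional, momentFunctional_eq_sum _ q.natDegree.lt_succ_self]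
  simp only [eval_eq_sum_range, Finset.sum_mul, mul_assoc]
  rw [integral_finsetSum _ fun k _ => ((integrable_pow_mul_weight h k).const_mul _).integrableOn]
  exact Finset.sum_congr rfl fun k _ => (integral_const_mul _ _).symm

/-- A nonzero polynomial has finitely many roots, so its square times the weight is positive almost
everywhere on an interval of positive length. -/
theorem posDefFunctional_weightFunctional (h : ∀ᶠ s' in 𝓝 s, Integrable (weight V S s'))
    {c d : ℝ} (hcd : c < d) (hE : Set.Ioo c d ⊆ E) (hS : Set.Ioo c d ⊆ S) :
    PosDefFunctional (weightFunctional V S E s) := by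
  intro q hq
  rw [weightFunctional_apply h, integral_pos_iff_support_of_nonneg
    (fun x => mul_nonneg (by simpa using mul_self_nonneg (q.eval x)) (weight_nonneg _ _ _ _))
    (integrable_eval_mul_weight h _).integrableOn]
  have hsub : Set.Ioo c d \ (q.roots.toFinset : Set ℝ) ⊆
      Function.support fun x => (q * q).eval x * weight V S s x := by
    rintro x ⟨hx, hxq⟩
    have hx0 : q.eval x ≠ 0 := by simpa [hq] using hxq
    simp only [Function.mem_support, eval_mul, weight_of_mem (hS hx)]
    exact mul_ne_zero (mul_ne_zero hx0 hx0) (Real.exp_pos _).ne'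
  refine lt_of_lt_of_le ?_ (measure_mono hsub)
  rw [measure_sdiff_null (Set.Finite.measure_zero (Finset.finite_toSet _) _),
    Measure.restrict_apply measurableSet_Ioo, Set.inter_eq_left.2 hE, Real.volume_Ioo]
  simpa using hcd

end Weight

/-! ### Heine's formula and the gap probability. -/

section Heine

variable {V : ℝ → ℝ} {S : Set ℝ} {E : Set ℝ} {s : ℝ} {n : ℕ}

theorem jointWeight_nonneg (V : ℝ → ℝ) (S : Set ℝ) (n : ℕ) (s : ℝ) (x : Fin n → ℝ) :
    0 ≤ jointWeight V S n s x :=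
  mul_nonneg (sq_nonneg _) (Finset.prod_nonneg fun _ _ => weight_nonneg _ _ _ _)

/-- Column operations let any monic polynomials of degrees `0, …, n-1` replace the monomials in the
Vandermonde determinant; its square expands over pairs of permutations. -/
theorem jointWeight_eq_sum (V : ℝ → ℝ) (S : Set ℝ) (s : ℝ) (p : Fin n → ℝ[X])
    (hd : ∀ i, (p i).natDegree = i) (hp : ∀ i, (p i).Monic) (x : Fin n → ℝ) :
    jointWeight V S n s x = ∑ σ : Equiv.Perm (Fin n), ∑ τ : Equiv.Perm (Fin n),
      ((Equiv.Perm.sign σ : ℤ) : ℝ) * ((Equiv.Perm.sign τ : ℤ) : ℝ) *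
        ∏ i, ((p (σ i) * p (τ i)).eval (x i) * weight V S s (x i)) := by
  have hdet : ∏ i : Fin n, ∏ j ∈ Finset.Ioi i, (x j - x i) =
      ∑ σ : Equiv.Perm (Fin n), ((Equiv.Perm.sign σ : ℤ) : ℝ) * ∏ i, (p (σ i)).eval (x i) := by
    rw [← Matrix.det_vandermonde, Matrix.det_eval_matrixOfPolynomials_eq_det_vandermonde x p hd hp,
      ← Matrix.det_transpose, Matrix.det_apply']
    rfl
  rw [jointWeight, hdet, pow_two, Finset.sum_mul_sum, Finset.sum_mul]
  refine Finset.sum_congr rfl fun σ _ => ?_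
  rw [Finset.sum_mul]
  refine Finset.sum_congr rfl fun τ _ => ?_
  simp only [eval_mul, Finset.prod_mul_distrib]
  ring

theorem integrable_jointWeight (h : ∀ᶠ s' in 𝓝 s, Integrable (weight V S s')) (n : ℕ) :
    Integrable (jointWeight V S n s) := by
  rw [funext (jointWeight_eq_sum V S s (fun i : Fin n => X ^ (i : ℕ)) (by simp)
    fun i => monic_X_pow _)]
  exact integrable_finsetSum _ fun σ _ => integrable_finsetSum _ fun τ _ =>
    (Integrable.fintype_prod fun i => integrable_eval_mul_weight h _).const_mul _

/-- The Heine formula for the matrix integral. -/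
theorem tau_eq_prod_sqNorm (h : ∀ᶠ s' in 𝓝 s, Integrable (weight V S s'))
    (hpos : PosDefFunctional (weightFunctional V S E s)) (n : ℕ) :
    tau V S n E s = ∏ j ∈ Finset.range n, sqNorm (weightFunctional V S E s) j := by
  set L := weightFunctional V S E s with hL
  have hset : {x : Fin n → ℝ | ∀ i, x i ∈ E} = Set.univ.pi fun _ => E := by ext; simp
  have hint : ∀ q : ℝ[X], IntegrableOn (fun x => q.eval x * weight V S s x) E := fun q =>
    (integrable_eval_mul_weight h q).integrableOn
  -- Distinct permutations differ at some index, where orthogonality kills the factor.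
  have hprod : ∀ σ τ : Equiv.Perm (Fin n),
      ∏ i, L (orthoPoly L (σ i) * orthoPoly L (τ i)) =
        if τ = σ then ∏ j ∈ Finset.range n, sqNorm L j else 0 := by
    intro σ τ
    split_ifs with hστ
    · subst hστ
      rw [Finset.prod_range]
      exact Equiv.prod_comp τ fun j : Fin n => sqNorm L j
    · obtain ⟨i, hi⟩ : ∃ i, τ i ≠ σ i := by
        by_contra! hcon
        exact hστ (Equiv.ext hcon)
      refine Finset.prod_eq_zero (Finset.mem_univ i) ?_
      rcases (Fin.val_injective.ne hi).lt_or_gt with hlt | hlt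
      · exact orthoPoly_mul_eq_zero_of_lt hpos hlt
      · rw [mul_comm]
        exact orthoPoly_mul_eq_zero_of_lt hpos hlt
  rw [tau, hset, volume_pi, Measure.restrict_pi_pi]
  simp only [jointWeight_eq_sum V S s (fun i : Fin n => orthoPoly L i)
    (fun i => natDegree_orthoPoly L i) fun i => monic_orthoPoly L i]
  have hI : ∀ σ τ : Equiv.Perm (Fin n), Integrable (fun x : Fin n → ℝ =>
      ((Equiv.Perm.sign σ : ℤ) : ℝ) * ((Equiv.Perm.sign τ : ℤ) : ℝ) *
        ∏ i, ((orthoPoly L (σ i) * orthoPoly L (τ i)).eval (x i) * weight V S s (x i)))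
      (Measure.pi fun _ => volume.restrict E) := fun σ τ =>
    (Integrable.fintype_prod fun i => hint _).const_mul _
  rw [integral_finsetSum _ fun σ _ => integrable_finsetSum _ fun τ _ => hI σ τ]
  have hterm : ∀ σ : Equiv.Perm (Fin n), (∫ x : Fin n → ℝ, ∑ τ : Equiv.Perm (Fin n),
      ((Equiv.Perm.sign σ : ℤ) : ℝ) * ((Equiv.Perm.sign τ : ℤ) : ℝ) *
        ∏ i, ((orthoPoly L (σ i) * orthoPoly L (τ i)).eval (x i) * weight V S s (x i))
      ∂(Measure.pi fun _ => volume.restrict E)) = ∏ j ∈ Finset.range n, sqNorm L j := by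
    intro σ
    rw [integral_finsetSum _ fun τ _ => hI σ τ, Finset.sum_eq_single σ]
    · rw [integral_const_mul, integral_fintype_prod_eq_prod
        (f := fun i y => (orthoPoly L (σ i) * orthoPoly L (σ i)).eval y * weight V S s y)]
      simp only [← weightFunctional_apply h, ← hL]
      rw [hprod, if_pos rfl, ← Int.cast_mul, Int.units_coe_mul_self, Int.cast_one, one_mul]
    · intro τ _ hτ
      rw [integral_const_mul, integral_fintype_prod_eq_prod
        (f := fun i y => (orthoPoly L (σ i) * orthoPoly L (τ i)).eval y * weight V S s y)]
      simp only [← weightFunctional_apply h, ← hL]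
      rw [hprod, if_neg hτ, mul_zero]
    · intro hσ
      exact absurd (Finset.mem_univ σ) hσ
  -- The `n!` diagonal terms are equal and cancel the prefactor `1/n!`.
  simp only [hterm, Finset.sum_const, Finset.card_univ, Fintype.card_perm, Fintype.card_fin,
    nsmul_eq_mul]
  have : (n.factorial : ℝ) ≠ 0 := by exact_mod_cast n.factorial_ne_zero
  field_simp

theorem tau_pos (h : ∀ᶠ s' in 𝓝 s, Integrable (weight V S s'))
    (hpos : PosDefFunctional (weightFunctional V S E s)) (n : ℕ) : 0 < tau V S n E s := by
  rw [tau_eq_prod_sqNorm h hpos]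
  exact Finset.prod_pos fun j _ => sqNorm_pos hpos j

theorem setIntegral_jointWeight (V : ℝ → ℝ) (S E : Set ℝ) (n : ℕ) (s : ℝ) :
    ∫ x in {x : Fin n → ℝ | ∀ i, x i ∈ E}, jointWeight V S n s x =
      n.factorial * tau V S n E s := by
  have : (n.factorial : ℝ) ≠ 0 := by exact_mod_cast n.factorial_ne_zero
  rw [tau]
  field_simp

theorem eigenvalueLaw_apply (h : ∀ᶠ s' in 𝓝 s, Integrable (weight V S s'))
    (h0 : 0 < tau V S n Set.univ s) (hE : MeasurableSet E) :
    eigenvalueLaw V S n s {x | ∀ i, x i ∈ E} =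
      ENNReal.ofReal (tau V S n E s / tau V S n Set.univ s) := by
  have hm : MeasurableSet {x : Fin n → ℝ | ∀ i, x i ∈ E} := by
    have : {x : Fin n → ℝ | ∀ i, x i ∈ E} = Set.univ.pi fun _ => E := by ext; simp
    rw [this]
    exact MeasurableSet.univ_pi fun _ => hE
  have hf : (0 : ℝ) < n.factorial := by exact_mod_cast n.factorial_pos
  rw [eigenvalueLaw, withDensity_apply _ hm, ← ofReal_integral_eq_lintegral_ofReal
    ((integrable_jointWeight h n).div_const _).integrableOn
    (Eventually.of_forall fun x => div_nonneg (jointWeight_nonneg _ _ _ _ _) (by positivity)),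
    integral_div, setIntegral_jointWeight, mul_div_mul_left _ _ hf.ne']

theorem isProbabilityMeasure_eigenvalueLaw (h : ∀ᶠ s' in 𝓝 s, Integrable (weight V S s'))
    (h0 : 0 < tau V S n Set.univ s) : IsProbabilityMeasure (eigenvalueLaw V S n s) := by
  have h1 := eigenvalueLaw_apply h h0 MeasurableSet.univ
  rw [div_self h0.ne', ENNReal.ofReal_one] at h1
  exact ⟨by simpa using h1⟩

theorem gapProb_eq_div (h : ∀ᶠ s' in 𝓝 s, Integrable (weight V S s'))
    (h0 : 0 < tau V S n Set.univ s) (hE : MeasurableSet E) (hE0 : 0 ≤ tau V S n E s) :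
    gapProb V S n E s = tau V S n E s / tau V S n Set.univ s := by
  simp only [gapProb, Set.mem_compl_iff, not_not]
  rw [measureReal_def, eigenvalueLaw_apply h h0 hE, ENNReal.toReal_ofReal (by positivity)]

end Heine

/-! ### Moving one endpoint of a union of intervals. -/

theorem measurableSet_intervals {m : ℕ} (a : Fin (2 * m) → EReal) :
    MeasurableSet (intervals a) := by
  rw [intervals, Set.ofPred_exists]
  exact MeasurableSet.iUnion fun j => (measurableSet_le measurable_const
    measurable_coe_real_ereal).inter (measurableSet_le measurable_coe_real_ereal measurable_const)

section Moved

variable {m : ℕ} {a : Fin (2 * m) → EReal} {k : Fin (2 * m)} {c d : ℝ}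

/-- Off an interval containing the moving endpoint, the union of intervals does not change. -/
theorem mem_movedIntervals_iff_of_notMem {x x' y : ℝ} (hx : x ∈ Set.Ioo c d)
    (hx' : x' ∈ Set.Ioo c d) (hy : y ∉ Set.Ioo c d) :
    y ∈ movedIntervals a k x ↔ y ∈ movedIntervals a k x' := by
  have hle : y ≤ c ∨ d ≤ y := by
    by_contra! hcon
    exact hy hcon
  refine exists_congr fun j => and_congr ?_ ?_
  · by_cases hk : (⟨2 * j, by omega⟩ : Fin (2 * m)) = k
    · rw [hk, Function.update_self, Function.update_self, EReal.coe_le_coe_iff,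
        EReal.coe_le_coe_iff]
      rcases hle with h | h
      · exact iff_of_false (by linarith [hx.1]) (by linarith [hx'.1])
      · exact iff_of_true (by linarith [hx.2]) (by linarith [hx'.2])
    · rw [Function.update_of_ne hk, Function.update_of_ne hk]
  · by_cases hk : (⟨2 * j + 1, by omega⟩ : Fin (2 * m)) = k
    · rw [hk, Function.update_self, Function.update_self, EReal.coe_le_coe_iff,
        EReal.coe_le_coe_iff]
      rcases hle with h | h
      · exact iff_of_true (by linarith [hx.1]) (by linarith [hx'.1])
      · exact iff_of_false (by linarith [hx.2]) (by linarith [hx'.2])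
    · rw [Function.update_of_ne hk, Function.update_of_ne hk]

/-- Near a moving left endpoint, the union of intervals is a half-line. -/
theorem mem_movedIntervals_iff_of_even (hc : ∀ i < k, a i ≤ c) (hd : ∀ i, k < i → d ≤ a i)
    (hk : Even (k : ℕ)) {x y : ℝ} (hy : y ∈ Set.Ioo c d) :
    y ∈ movedIntervals a k x ↔ x ≤ y := by
  have hcy : (c : EReal) < y := EReal.coe_lt_coe_iff.2 hy.1
  have hyd : (y : EReal) < d := EReal.coe_lt_coe_iff.2 hy.2
  obtain ⟨l, hl⟩ := hk
  have hlt := k.2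
  constructor
  · rintro ⟨j, h1, h2⟩
    rcases lt_trichotomy (2 * (j : ℕ)) k with hj | hj | hj
    · have hjk : (⟨2 * j + 1, by omega⟩ : Fin (2 * m)) < k := Fin.lt_def.2 (by simp only; omega)
      rw [Function.update_of_ne hjk.ne] at h2
      exact absurd (hcy.trans_le (h2.trans (hc _ hjk))) (lt_irrefl _)
    · have hjk : (⟨2 * j, by omega⟩ : Fin (2 * m)) = k := Fin.ext hj
      rw [hjk, Function.update_self] at h1
      exact EReal.coe_le_coe_iff.1 h1
    · have hjk : k < (⟨2 * j, by omega⟩ : Fin (2 * m)) := Fin.lt_def.2 hj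
      rw [Function.update_of_ne hjk.ne'] at h1
      exact absurd (((hd _ hjk).trans h1).trans_lt hyd) (lt_irrefl _)
  · intro hxy
    refine ⟨⟨l, by omega⟩, ?_, ?_⟩
    · have hjk : (⟨2 * l, by omega⟩ : Fin (2 * m)) = k := Fin.ext (by simp only; omega)
      simp only [hjk, Function.update_self]
      exact EReal.coe_le_coe_iff.2 hxy
    · have hjk : k < (⟨2 * l + 1, by omega⟩ : Fin (2 * m)) :=
        Fin.lt_def.2 (by simp only; omega)
      simp only [Function.update_of_ne hjk.ne']
      exact hyd.le.trans (hd _ hjk)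

/-- Near a moving right endpoint, the union of intervals is a half-line. -/
theorem mem_movedIntervals_iff_of_not_even (hc : ∀ i < k, a i ≤ c) (hd : ∀ i, k < i → d ≤ a i)
    (hk : ¬Even (k : ℕ)) {x y : ℝ} (hy : y ∈ Set.Ioo c d) :
    y ∈ movedIntervals a k x ↔ y ≤ x := by
  have hcy : (c : EReal) < y := EReal.coe_lt_coe_iff.2 hy.1
  have hyd : (y : EReal) < d := EReal.coe_lt_coe_iff.2 hy.2
  obtain ⟨l, hl⟩ := Nat.not_even_iff_odd.1 hk
  have hlt := k.2
  constructor
  · rintro ⟨j, h1, h2⟩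
    rcases lt_trichotomy (2 * (j : ℕ) + 1) k with hj | hj | hj
    · have hjk : (⟨2 * j + 1, by omega⟩ : Fin (2 * m)) < k := Fin.lt_def.2 hj
      rw [Function.update_of_ne hjk.ne] at h2
      exact absurd (hcy.trans_le (h2.trans (hc _ hjk))) (lt_irrefl _)
    · have hjk : (⟨2 * j + 1, by omega⟩ : Fin (2 * m)) = k := Fin.ext hj
      rw [hjk, Function.update_self] at h2
      exact EReal.coe_le_coe_iff.1 h2
    · have hjk : k < (⟨2 * j, by omega⟩ : Fin (2 * m)) := Fin.lt_def.2 (by simp only; omega)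
      rw [Function.update_of_ne hjk.ne'] at h1
      exact absurd (((hd _ hjk).trans h1).trans_lt hyd) (lt_irrefl _)
  · intro hxy
    refine ⟨⟨l, by omega⟩, ?_, ?_⟩
    · have hjk : (⟨2 * l, by omega⟩ : Fin (2 * m)) < k := Fin.lt_def.2 (by simp only; omega)
      simp only [Function.update_of_ne hjk.ne]
      exact (hc _ hjk).trans hcy.le
    · have hjk : (⟨2 * l + 1, by omega⟩ : Fin (2 * m)) = k := Fin.ext (by simp only; omega)
      simp only [hjk, Function.update_self]
      exact EReal.coe_le_coe_iff.2 hxy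

/-- The sign with which the weight at the `k`-th endpoint enters the derivative of an integral
over the union of intervals. -/
def edgeSign {N : ℕ} (k : Fin N) : ℝ := if Even (k : ℕ) then -1 else 1

/-- In the window `Ioo c d` the set is a half-line ending at the moving point, and outside it is
fixed. The integral is thus a constant plus an interval integral with one variable limit,
differentiated by the fundamental theorem of calculus. -/
theorem hasDerivAt_setIntegral_movedIntervals (hc : ∀ i < k, a i ≤ c)
    (hd : ∀ i, k < i → d ≤ a i) {f : ℝ → ℝ} (hf : Integrable f) {x₀ : ℝ}
    (hx₀ : x₀ ∈ Set.Ioo c d) (hcont : ContinuousAt f x₀) :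
    HasDerivAt (fun x => ∫ y in movedIntervals a k x, f y) (edgeSign k * f x₀) x₀ := by
  set F := movedIntervals a k x₀ \ Set.Ioo c d with hF
  have hmeas := hf.aestronglyMeasurable.stronglyMeasurableAtFilter (l := 𝓝 x₀)
  by_cases hk : Even (k : ℕ)
  · have h1 := (intervalIntegral.integral_hasDerivAt_left
      (hf.intervalIntegrable (a := x₀) (b := d)) hmeas hcont).const_add (∫ y in F, f y)
    rw [edgeSign, if_pos hk, neg_one_mul]
    refine h1.congr_of_eventuallyEq ?_
    filter_upwards [isOpen_Ioo.mem_nhds hx₀] with x hx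
    -- The point `d` is excluded: it lies outside the window and is accounted for by `F`.
    have hset : movedIntervals a k x = F ∪ Set.Ico x d := by
      ext y
      by_cases hy : y ∈ Set.Ioo c d
      · simp [hF, hy, mem_movedIntervals_iff_of_even hc hd hk hy, hy.2]
      · rw [mem_movedIntervals_iff_of_notMem hx hx₀ hy]
        have : y ∉ Set.Ico x d := fun h => hy ⟨hx.1.trans_le h.1, h.2⟩
        simp [hF, hy, this]
    have hdisj : Disjoint F (Set.Ico x d) := by
      rw [Set.disjoint_left]
      exact fun y hyF h => hyF.2 ⟨hx.1.trans_le h.1, h.2⟩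
    rw [hset, setIntegral_union hdisj measurableSet_Ico hf.integrableOn hf.integrableOn,
      integral_Ico_eq_integral_Ioo, ← integral_Ioc_eq_integral_Ioo,
      ← intervalIntegral.integral_of_le hx.2.le]
  · have h1 := (intervalIntegral.integral_hasDerivAt_right
      (hf.intervalIntegrable (a := c) (b := x₀)) hmeas hcont).const_add (∫ y in F, f y)
    rw [edgeSign, if_neg hk, one_mul]
    refine h1.congr_of_eventuallyEq ?_
    filter_upwards [isOpen_Ioo.mem_nhds hx₀] with x hx
    have hset : movedIntervals a k x = F ∪ Set.Ioc c x := by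
      ext y
      by_cases hy : y ∈ Set.Ioo c d
      · simp [hF, hy, mem_movedIntervals_iff_of_not_even hc hd hk hy, hy.1]
      · rw [mem_movedIntervals_iff_of_notMem hx hx₀ hy]
        have : y ∉ Set.Ioc c x := fun h => hy ⟨h.1, h.2.trans_lt hx.2⟩
        simp [hF, hy, this]
    have hdisj : Disjoint F (Set.Ioc c x) := by
      rw [Set.disjoint_left]
      exact fun y hyF h => hyF.2 ⟨h.1, h.2.trans_lt hx.2⟩
    rw [hset, setIntegral_union hdisj measurableSet_Ioc hf.integrableOn hf.integrableOn,
      ← intervalIntegral.integral_of_le hx.1.le]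

theorem exists_Ioo_subset_movedIntervals (hc : ∀ i < k, a i ≤ c) (hd : ∀ i, k < i → d ≤ a i)
    {x : ℝ} (hx : x ∈ Set.Ioo c d) :
    ∃ c' d' : ℝ, c' < d' ∧ Set.Ioo c' d' ⊆ Set.Ioo c d ∧
      Set.Ioo c' d' ⊆ movedIntervals a k x := by
  by_cases hk : Even (k : ℕ)
  · refine ⟨x, d, hx.2, Set.Ioo_subset_Ioo_left hx.1.le, fun y hy => ?_⟩
    exact (mem_movedIntervals_iff_of_even hc hd hk ⟨hx.1.trans hy.1, hy.2⟩).2 hy.1.le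
  · refine ⟨c, x, hx.1, Set.Ioo_subset_Ioo_right hx.2.le, fun y hy => ?_⟩
    exact (mem_movedIntervals_iff_of_not_even hc hd hk ⟨hy.1, hy.2.trans hx.2⟩).2 hy.2.le

/-- A neighbourhood of a finite endpoint contains an interval around it with no other endpoint. -/
theorem exists_Ioo_isolating (ha : StrictMono a) {ξ : ℝ} (hξ : a k = (ξ : EReal)) {N : Set ℝ}
    (hN : N ∈ 𝓝 ξ) : ∃ c d : ℝ, ξ ∈ Set.Ioo c d ∧ Set.Ioo c d ⊆ N ∧
      (∀ i < k, a i ≤ c) ∧ ∀ i, k < i → d ≤ a i := by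
  have h1 : ∀ i, ∀ᶠ x : ℝ in 𝓝 ξ, (i < k → a i < x) ∧ (k < i → (x : EReal) < a i) := by
    intro i
    have hcont : Tendsto (fun x : ℝ => (x : EReal)) (𝓝 ξ) (𝓝 (ξ : EReal)) :=
      continuous_coe_real_ereal.tendsto ξ
    rcases lt_trichotomy i k with h | h | h
    · have := hcont.eventually (lt_mem_nhds (hξ ▸ ha h))
      filter_upwards [this] with x hx using ⟨fun _ => hx, fun h' => absurd h h'.asymm⟩
    · exact Eventually.of_forall fun x => ⟨fun h' => absurd h h'.ne, fun h' => absurd h h'.ne'⟩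
    · have := hcont.eventually (gt_mem_nhds (hξ ▸ ha h))
      filter_upwards [this] with x hx using ⟨fun h' => absurd h h'.asymm, fun _ => hx⟩
  obtain ⟨ε, hε, hball⟩ := Metric.eventually_nhds_iff.1
    ((eventually_all.2 h1).and (show ∀ᶠ x in 𝓝 ξ, x ∈ N from hN))
  have hdist : ∀ y, |y - ξ| < ε → _ := fun y hy => hball (y := y) (by rwa [Real.dist_eq])
  -- Half the radius keeps `c` and `d` themselves in the ball, where the comparisons with the other
  -- endpoints hold.
  refine ⟨ξ - ε / 2, ξ + ε / 2, ⟨by linarith, by linarith⟩, fun y hy => ?_, fun i hi => ?_,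
    fun i hi => ?_⟩
  · exact (hdist y (by rw [abs_lt]; constructor <;> linarith [hy.1, hy.2])).2
  · exact (((hdist (ξ - ε / 2) (by rw [abs_lt]; constructor <;> linarith)).1 i).1 hi).le
  · exact (((hdist (ξ + ε / 2) (by rw [abs_lt]; constructor <;> linarith)).1 i).2 hi).le

/-- The moments of the weight on the union of intervals, as functions of an endpoint and of the
first Toda time. -/
theorem isMomentFamily_weightMoment {V : ℝ → ℝ} {S : Set ℝ} (hc : ∀ i < k, a i ≤ c)
    (hd : ∀ i, k < i → d ≤ a i) (hS : Set.Ioo c d ⊆ S)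
    (hV : ∀ x ∈ Set.Ioo c d, DifferentiableAt ℝ V x) {I : Set ℝ} (hI : IsOpen I)
    (ht : ∀ s ∈ I, Integrable (weight V S s)) :
    IsMomentFamily (Set.Ioo c d ×ˢ I)
      (fun j x s => weightMoment V S (movedIntervals a k x) j s)
      (fun x s => edgeSign k * Real.exp (-V x + s * x))
      (fun x s => edgeSign k * (Real.exp (-V x + s * x) * (-deriv V x + s))) := by
  have hev : ∀ s ∈ I, ∀ᶠ s' in 𝓝 s, Integrable (weight V S s') := fun s hs => by
    filter_upwards [hI.mem_nhds hs] with s' hs' using ht s' hs'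
  refine ⟨isOpen_Ioo.prod hI, fun p hp => ?_, fun p hp j => ?_, fun p hp j => ?_, fun p hp => ?_,
    fun p hp => ?_, fun p hp => ?_⟩
  · obtain ⟨c', d', hcd, hsub, hE⟩ := exists_Ioo_subset_movedIntervals hc hd hp.1
    exact posDefFunctional_weightFunctional (hev _ hp.2) hcd hE (hsub.trans hS)
  · have hcont : ContinuousAt (fun y => y ^ j * weight V S p.2 y) p.1 := by
      have h1 : ContinuousAt (fun y => y ^ j * Real.exp (-V y + p.2 * y)) p.1 := by
        have := (hV p.1 hp.1).continuousAt
        fun_prop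
      refine h1.congr ?_
      filter_upwards [isOpen_Ioo.mem_nhds hp.1] with y hy
      rw [weight_of_mem (hS hy)]
    refine (hasDerivAt_setIntegral_movedIntervals hc hd (integrable_pow_mul_weight (hev _ hp.2) j)
      hp.1 hcont).congr_deriv ?_
    rw [weight_of_mem (hS hp.1)]
    ring
  · exact hasDerivAt_weightMoment (hev _ hp.2) j
  · refine ((((hV p.1 hp.1).hasDerivAt.neg.add
      ((hasDerivAt_id p.1).const_mul p.2)).exp).const_mul (edgeSign k)).congr_deriv ?_
    simp
  · refine (((((hasDerivAt_id p.2).mul_const p.1).const_add (-V p.1)).exp).const_mul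
      (edgeSign k)).congr_deriv ?_
    simp
    ring
  · have h1 := (((hasDerivAt_id p.2).mul_const p.1).const_add (-V p.1)).exp
    refine ((h1.fun_mul ((hasDerivAt_id p.2).const_add (-deriv V p.1))).const_mul
      (edgeSign k)).congr_deriv ?_
    simp
    ring

end Moved

end

end UnitaryEnsemble

/-! ### The theorem for unitary ensembles. -/

theorem theorem7
    -- the potential, the set on which it is finite, and the matrix size
    (V : ℝ → ℝ) (S : Set ℝ) (n : ℕ)
    -- the endpoints of `J`, in increasing order, and one finite endpoint `ξ` among them
    {m : ℕ} (a : Fin (2 * m) → EReal) (ha : StrictMono a)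
    (k : Fin (2 * m)) (ξ : ℝ) (hξ : a k = (ξ : EReal))
    (hS : ξ ∈ interior S) (hV : ∀ᶠ x in 𝓝 ξ, DifferentiableAt ℝ V x)
    -- the modified ensemble exists for Toda times near `t`
    (t : ℝ) (ht : ∀ᶠ s in 𝓝 t, Integrable (UnitaryEnsemble.weight V S s)) :
    (∀ᶠ p in 𝓝 (ξ, t),
      IsProbabilityMeasure (UnitaryEnsemble.eigenvalueLaw V S n p.2) ∧
      0 < UnitaryEnsemble.tau V S n Set.univ p.2 ∧
      0 < UnitaryEnsemble.tau V S n (UnitaryEnsemble.movedIntervals a k p.1) p.2 ∧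
      0 < UnitaryEnsemble.gapProb V S n (UnitaryEnsemble.movedIntervals a k p.1) p.2 ∧
      UnitaryEnsemble.logTau V S n a k p.1 p.2 =
        Real.log (UnitaryEnsemble.gapProb V S n (UnitaryEnsemble.movedIntervals a k p.1) p.2) +
          Real.log (UnitaryEnsemble.tau V S n Set.univ p.2)) ∧
    ∃ Tξ Tt Tξξ Tξt Ttt Tξξt Tξtt Tξξtt : ℝ → ℝ → ℝ,
      ∀ᶠ p in 𝓝 (ξ, t),
        -- these functions are the iterated partial derivatives of `T`, in any order
        UnitaryEnsemble.HasPartialXi (UnitaryEnsemble.logTau V S n a k) Tξ p ∧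
        UnitaryEnsemble.HasPartialT (UnitaryEnsemble.logTau V S n a k) Tt p ∧
        UnitaryEnsemble.HasPartialXi Tξ Tξξ p ∧
        UnitaryEnsemble.HasPartialT Tξ Tξt p ∧
        UnitaryEnsemble.HasPartialXi Tt Tξt p ∧
        UnitaryEnsemble.HasPartialT Tt Ttt p ∧
        UnitaryEnsemble.HasPartialT Tξξ Tξξt p ∧
        UnitaryEnsemble.HasPartialXi Tξt Tξξt p ∧
        UnitaryEnsemble.HasPartialT Tξt Tξtt p ∧
        UnitaryEnsemble.HasPartialXi Ttt Tξtt p ∧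
        UnitaryEnsemble.HasPartialT Tξξt Tξξtt p ∧
        UnitaryEnsemble.HasPartialXi Tξtt Tξξtt p ∧
        -- the universal PDE
        (Tξt p.1 p.2 * Tξξtt p.1 p.2 - Tξtt p.1 p.2 * Tξξt p.1 p.2 + 2 * Tξt p.1 p.2 ^ 3) ^ 2 =
          Tξ p.1 p.2 ^ 2 * (4 * Ttt p.1 p.2 * Tξt p.1 p.2 ^ 2 + Tξtt p.1 p.2 ^ 2) := by

  -- The window `Ioo c d` around `ξ` lies in `S`, contains no other endpoint, and `V` is
  -- differentiable on it.
  obtain ⟨c, d, hcd, hsub, hc, hd⟩ := UnitaryEnsemble.exists_Ioo_isolating ha hξ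
    (inter_mem (mem_interior_iff_mem_nhds.1 hS) hV)
  obtain ⟨I, hIt, hI, htI⟩ := mem_nhds_iff.1 ht
  have hU : Set.Ioo c d ×ˢ I ∈ 𝓝 (ξ, t) :=
    (isOpen_Ioo.prod hI).mem_nhds ⟨hcd, htI⟩
  have H := UnitaryEnsemble.isMomentFamily_weightMoment (V := V) (S := S) hc hd
    (fun x hx => (hsub hx).1) (fun x hx => (hsub hx).2) hI hIt
  have hev : ∀ s ∈ I, ∀ᶠ s' in 𝓝 s, Integrable (UnitaryEnsemble.weight V S s') := fun s hs => by
    filter_upwards [hI.mem_nhds hs] with s' hs' using hIt hs'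
  constructor
  · filter_upwards [hU] with p hp
    have h1 := hev _ hp.2
    have hτ : 0 < UnitaryEnsemble.tau V S n Set.univ p.2 := UnitaryEnsemble.tau_pos h1
      (UnitaryEnsemble.posDefFunctional_weightFunctional h1 (hcd.1.trans hcd.2)
        (Set.subset_univ _) fun x hx => (hsub hx).1) n
    have hτJ : 0 < UnitaryEnsemble.tau V S n (UnitaryEnsemble.movedIntervals a k p.1) p.2 :=
      UnitaryEnsemble.tau_pos h1 (H.posDef p hp) n
    have hgap := UnitaryEnsemble.gapProb_eq_div (n := n) h1 hτ
      (UnitaryEnsemble.measurableSet_intervals (Function.update a k (p.1 : EReal))) hτJ.le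
    change UnitaryEnsemble.gapProb V S n (UnitaryEnsemble.movedIntervals a k p.1) p.2 =
      UnitaryEnsemble.tau V S n (UnitaryEnsemble.movedIntervals a k p.1) p.2 / _ at hgap
    refine ⟨UnitaryEnsemble.isProbabilityMeasure_eigenvalueLaw h1 hτ, hτ, hτJ, ?_, ?_⟩
    · rw [hgap]
      exact div_pos hτJ hτ
    · rw [hgap, Real.log_div hτJ.ne' hτ.ne', sub_add_cancel]
      rfl
  -- Heine's formula identifies `T` on the whole neighbourhood with the sum of the logarithms of the
  -- norms.
  · obtain ⟨Tξ, Tt, Tξξ, Tξt, Ttt, Tξξt, Tξtt, Tξξtt, h⟩ := H.exists_partials n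
      (T := UnitaryEnsemble.logTau V S n a k) fun p hp => by
        have hpos : UnitaryEnsemble.PosDefFunctional (UnitaryEnsemble.weightFunctional V S
          (UnitaryEnsemble.movedIntervals a k p.1) p.2) := H.posDef p hp
        rw [UnitaryEnsemble.logTau, UnitaryEnsemble.tau_eq_prod_sqNorm (hev _ hp.2) hpos,
          Real.log_prod fun j _ => (UnitaryEnsemble.sqNorm_pos hpos j).ne']
        rfl
    refine ⟨Tξ, Tt, Tξξ, Tξt, Ttt, Tξξt, Tξtt, Tξξtt, ?_⟩
    filter_upwards [hU] with p hp using h p hp
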